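/- Fix $s\in\mathbb C\setminus\{0\}$ with $|s|\neq 1$ and put $q=s^2$, $q^{1/2}=s$, $(q^{-1})^{1/2}=s^{-1}$ (so all functions below are functions of the chosen square root of $q$). Write $(x;q)_m=\prod_{j=0}^{m-1}(1-xq^j)$ and, for $|q|<1$, $(x;q)_\infty=\prod_{j\ge 0}(1-xq^j)$, $\theta(x;q)=(-q^{1/2}x;q)_\infty(-q^{1/2}x^{-1};q)_\infty$ and $C(q)=(q;q)_\infty(-q^{1/2};q)_\infty^2$. The holomorphic blocks of the $4_1$ knot are the functions, meromorphic in $x\in\mathbb C\setminus\{0\}$, given for $|q|<1$ by $$B^{(1)}(x;q)=\frac{(qx^2;q)_\infty}{\theta(x;q)\,\theta(-q^{1/2}x;q)}\sum_{k\ge 0}(-1)^k\frac{q^{k(k+1)/2}x^k}{(q;q)_k(qx^2;q)_k},$$ $$B^{(1)}(x;q^{-1})=\frac{\theta(x;q)\,\theta(-q^{-1/2}x;q)}{(x^2;q)_\infty}\sum_{k\ge 0}(-1)^k\frac{q^{k(k+1)/2}x^{-k}}{(q;q)_k(qx^{-2};q)_k},$$ and $B^{(2)}(x;q^{\pm1})=B^{(1)}(x^{-1};q^{\pm1})$.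 For $n\in\mathbb Z$ the colored holomorphic blocks $h^{(0)}_n(q)$, $h^{(1)}_n(q)$ ($|q|\ne 1$) are defined by the expansions at $u=0$: for $|q|<1$, $$B^{(1)}(q^ne^u;q)=\frac{h^{(0)}_n(q)}{C(q)}u^{-1}+O(1),\qquad B^{(1)}(q^ne^u;q)+B^{(2)}(q^ne^u;q)=\frac{h^{(1)}_n(q)}{C(q)}+O(u),$$ and, for $|q|<1$, $$B^{(1)}(q^{-n}e^{-u};q^{-1})=\frac{C(q)}{2}h^{(0)}_n(q^{-1})+O(u),$$ $$B^{(1)}(q^{-n}e^{-u};q^{-1})-B^{(2)}(q^{-n}e^{-u};q^{-1})=-\frac{C(q)}{2}h^{(1)}_n(q^{-1})\,u+O(u^2).$$ Let $E_1(q)=\frac{\zeta(0)}{2}+\sum_{j\ge1}\frac{q^j}{1-q^j}=-\frac14+\sum_{j\ge1}\frac{q^j}{1-q^j}$ for $|q|<1$, extended to $|q|>1$ by $E_1(q^{-1})=-E_1(q)$. Proposition. For every $n\in\mathbb Z$ and every $q\neq 0$ with $|q|\neq1$ (both for $|q|<1$ and for $|q|>1$), these expansions hold (so that $h^{(0)}_n$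 and $h^{(1)}_n$ are well defined), and, with absolutely convergent series, $$h_n^{(0)}(q)=(-1)^nq^{|n|(2|n|+1)/2}\sum_{k=0}^\infty(-1)^k\frac{q^{k(k+1)/2+|n|k}}{(q;q)_k(q;q)_{k+2|n|}},$$ $$\begin{aligned}h_n^{(1)}(q)&=(-1)^nq^{|n|(2|n|+1)/2}\sum_{k=0}^\infty\Bigl(-4E_1(q)+\sum_{\ell=1}^{k+2|n|}\frac{1+q^\ell}{1-q^\ell}+\sum_{\ell=1}^{k}\frac{1+q^\ell}{1-q^\ell}\Bigr)(-1)^k\frac{q^{k(k+1)/2+|n|k}}{(q;q)_k(q;q)_{k+2|n|}}\\&\quad-2(-1)^nq^{|n|(2|n|-1)/2}\sum_{k=0}^{2|n|-1}(-1)^k\frac{q^{k(k+1)/2-|n|k}(q^{-1};q^{-1})_{2|n|-1-k}}{(q;q)_k}.\end{aligned}$$ Moreover $$h_n^{(0)}(q^{-1})=h_n^{(0)}(q),\qquad h_n^{(1)}(q^{-1})=-h_n^{(1)}(q),\qquad h_{-n}^{(\alpha)}(q)=h_n^{(\alpha)}(q)\quad(\alpha=0,1).$$ -/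

import Mathlib

open Filter Topology Asymptotics

noncomputable section

namespace FigureEight

/-! Throughout, `s` is a fixed square root `q^{1/2}` of `q`, so `q = s ^ 2`, and the chosen square
root of `q⁻¹` is `s⁻¹`. All functions of `q` that involve `q^{1/2}` take `s` as an argument. -/

/-- The finite `q`-Pochhammer symbol `(x; q)_m = ∏_{j < m} (1 - x q^j)`. -/
def qPoch (x q : ℂ) (m : ℕ) : ℂ := ∏ j ∈ Finset.range m, (1 - x * q ^ j)

/-- The infinite `q`-Pochhammer symbol `(x; q)_∞ = ∏_{j ≥ 0} (1 - x q^j)`, for `|q| < 1`. -/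
def qPochInf (x q : ℂ) : ℂ := ∏' j : ℕ, (1 - x * q ^ j)

/-- `θ(x; q) = (-q^{1/2} x; q)_∞ (-q^{1/2} x^{-1}; q)_∞`, for `|q| < 1`. -/
def theta (s x : ℂ) : ℂ := qPochInf (-s * x) (s ^ 2) * qPochInf (-s * x⁻¹) (s ^ 2)

/-- `B^{(1)}(x; q)` for `|q| < 1`, where `q = s ^ 2`; note `q^{k(k+1)/2} = s^{k(k+1)}`. -/
def blockInside (s x : ℂ) : ℂ :=
  qPochInf (s ^ 2 * x ^ 2) (s ^ 2) / (theta s x * theta s (-s * x)) *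
    ∑' k : ℕ, (-1) ^ k * (s ^ (k * (k + 1)) * x ^ k) /
      (qPoch (s ^ 2) (s ^ 2) k * qPoch (s ^ 2 * x ^ 2) (s ^ 2) k)

/-- `B^{(1)}(x; q⁻¹)` for `|q| < 1`, as a function of `q^{1/2} = s`. -/
def blockOutside (s x : ℂ) : ℂ :=
  theta s x * theta s (-s⁻¹ * x) / qPochInf (x ^ 2) (s ^ 2) *
    ∑' k : ℕ, (-1) ^ k * (s ^ (k * (k + 1)) * (x⁻¹) ^ k) /
      (qPoch (s ^ 2) (s ^ 2) k * qPoch (s ^ 2 * (x⁻¹) ^ 2) (s ^ 2) k)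

/-- The holomorphic block `B^{(1)}(x; q)`, `q = s ^ 2`, for `|q| ≠ 1`. -/
def block1 (s x : ℂ) : ℂ := if ‖s‖ < 1 then blockInside s x else blockOutside s⁻¹ x

/-- The holomorphic block `B^{(2)}(x; q) = B^{(1)}(x⁻¹; q)`. -/
def block2 (s x : ℂ) : ℂ := block1 s x⁻¹

/-- The normalizing factor `(q; q)_∞ (-q^{1/2}; q)_∞ ^ 2`, for `|q| < 1`. -/
def normFactor (s : ℂ) : ℂ := qPochInf (s ^ 2) (s ^ 2) * qPochInf (-s) (s ^ 2) ^ 2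

/-- The point `q^n e^u`. -/
def pt (s : ℂ) (n : ℤ) (u : ℂ) : ℂ := (s ^ 2) ^ n * Complex.exp u

/-- The colored holomorphic block `h^{(0)}_n(q)`, `q = s ^ 2`, defined as the leading coefficient:
for `|q| < 1`, `B^{(1)}(q^n e^u; q) = h^{(0)}_n(q) u⁻¹ / C(q) + O(1)`;
for `|q| > 1`, `B^{(1)}(q^n e^{-u}; q) = (C(q⁻¹) / 2) h^{(0)}_n(q) + O(u)`,
where `C` is `normFactor`. -/
def h0 (s : ℂ) (n : ℤ) : ℂ :=
  if ‖s‖ < 1 then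
    limUnder (𝓝[≠] (0 : ℂ)) fun u => normFactor s * (u * block1 s (pt s n u))
  else
    limUnder (𝓝[≠] (0 : ℂ)) fun u => 2 / normFactor s⁻¹ * block1 s (pt s n (-u))

/-- The colored holomorphic block `h^{(1)}_n(q)`, `q = s ^ 2`, defined as the leading coefficient:
for `|q| < 1`,
`B^{(1)}(q^n e^u; q) + B^{(2)}(q^n e^u; q) = h^{(1)}_n(q) / C(q) + O(u)`;
for `|q| > 1`,
`B^{(1)}(q^n e^{-u}; q) - B^{(2)}(q^n e^{-u}; q) = -(C(q⁻¹) / 2) h^{(1)}_n(q) u + O(u^2)`,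
where `C` is `normFactor`. -/
def h1 (s : ℂ) (n : ℤ) : ℂ :=
  if ‖s‖ < 1 then
    limUnder (𝓝[≠] (0 : ℂ)) fun u =>
      normFactor s * (block1 s (pt s n u) + block2 s (pt s n u))
  else
    limUnder (𝓝[≠] (0 : ℂ)) fun u =>
      -(2 / normFactor s⁻¹) * ((block1 s (pt s n (-u)) - block2 s (pt s n (-u))) / u)

/-- The series `ζ(1 - ℓ)/2 + ∑_{j ≥ 1} j^{ℓ-1} q^j / (1 - q^j)`, for `ℓ ≥ 1` and `|q| < 1`. -/
def eisensteinSeries (ℓ : ℕ) (q : ℂ) : ℂ :=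
  riemannZeta (1 - (ℓ : ℂ)) / 2 +
    ∑' j : ℕ, ((j + 1 : ℕ) : ℂ) ^ (ℓ - 1) * (q ^ (j + 1) / (1 - q ^ (j + 1)))

/-- `E_ℓ(q)` for `|q| ≠ 1`, extended to `|q| > 1` by `E_ℓ(q⁻¹) = -E_ℓ(q)`. -/
def E (ℓ : ℕ) (q : ℂ) : ℂ :=
  if ‖q‖ < 1 then eisensteinSeries ℓ q else -eisensteinSeries ℓ q⁻¹

/-- The `q`-harmonic sum `∑_{ℓ=1}^m (1 + q^ℓ) / (1 - q^ℓ)`. -/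
def qHarm (q : ℂ) (m : ℕ) : ℂ := ∑ ℓ ∈ Finset.Icc 1 m, (1 + q ^ ℓ) / (1 - q ^ ℓ)

/-- The summand `(-1)^k q^{k(k+1)/2 + m k} / ((q; q)_k (q; q)_{k+2m})`. -/
def term (s : ℂ) (m k : ℕ) : ℂ :=
  (-1) ^ k * s ^ (k * (k + 1) + 2 * m * k) /
    (qPoch (s ^ 2) (s ^ 2) k * qPoch (s ^ 2) (s ^ 2) (k + 2 * m))

end FigureEight

end

/-! Write `P = (·; q)_∞`, `F` for `blockSeries`, `T` for `thetaShift`, `D` for `blockDenom`.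
Multiplying the block series by its prefactor `(q y²; q)_∞` removes all its denominators in `y`, so
`F` is entire, and for `|q| < 1` B⁽¹⁾(y; q) = F(y) / D(y), B⁽¹⁾(y⁻¹; q⁻¹) = D(y) F(y) / T(y²). Both
`D` and `y ↦ T(y²)` have simple zeros at the points `q^n`. From `D(y⁻¹) = -y D(y)` and `T(y⁻¹) = -y
T(y)`, the sum of the blocks at `q` and their difference at `q⁻¹` are obtained by replacing `F(y)`
with `G(y) = F(y) - y⁻¹ F(y⁻¹)` (`blockDiff`).

The key identity is `F(q^{-m}) = q^m F(q^m)` (`blockSeries_inv_pow`): the first `2m` terms at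
`q^{-m}` contain zeros of `P`, and the others are the terms at `q^m`. Hence `G(q^n) = 0`, which
gives the orders of the expansions. In both regimes `h⁽⁰⁾` is a constant times `F(q^n)` and `h⁽¹⁾` a
constant times the `u`-derivative of `G(q^n e^u)` at `0`. The constants agree up to the sign in
`h⁽¹⁾` (`div_blockDenom_deriv`, `blockDenom_deriv_mul_div`), whence the symmetry in `q ↔ q⁻¹`.

For the closed formulas, `F` is differentiated termwise. Logarithmic derivatives of `P` at positive
powers of `q` produce `E₁` and the harmonic sums; the derivatives of `P` at its zeros produce the
finite sum. For `|q| > 1` the formulas follow because they transform in the same way under `q ↦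
q⁻¹`, term by term. -/

namespace FigureEight

/-! ### The infinite q-Pochhammer symbol and its derivative -/

variable {q : ℂ}

theorem summable_norm_neg_mul_pow (hq : ‖q‖ < 1) (x : ℂ) :
    Summable fun j : ℕ => ‖-(x * q ^ j)‖ := by
  simp only [norm_neg, norm_mul, norm_pow]
  exact (summable_geometric_of_lt_one (norm_nonneg _) hq).mul_left _

theorem multipliable_one_sub_mul_pow (hq : ‖q‖ < 1) (x : ℂ) :
    Multipliable fun j : ℕ => 1 - x * q ^ j := by
  simpa only [sub_eq_add_neg] using
    multipliable_one_add_of_summable (summable_norm_neg_mul_pow hq x)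

theorem qPochInf_eq_mul (hq : ‖q‖ < 1) (x : ℂ) :
    qPochInf x q = (1 - x) * qPochInf (x * q) q := by
  have h : ∀ j : ℕ, 1 - x * q * q ^ j = 1 - x * q ^ (j + 1) := fun j => by ring
  have hm := multipliable_one_sub_mul_pow hq (x * q)
  simp only [h] at hm
  simp only [qPochInf, h]
  rw [tprod_eq_zero_mul' (f := fun j : ℕ => 1 - x * q ^ j) hm, pow_zero, mul_one]

theorem qPochInf_eq_qPoch_mul (hq : ‖q‖ < 1) (x : ℂ) (m : ℕ) :
    qPochInf x q = qPoch x q m * qPochInf (x * q ^ m) q := by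
  induction m with
  | zero => simp [qPoch]
  | succ m ih =>
    rw [ih, qPochInf_eq_mul hq (x * q ^ m), qPoch, qPoch, Finset.prod_range_succ, pow_succ]
    ring_nf

theorem qPochInf_ne_zero (hq : ‖q‖ < 1) {x : ℂ} (hx : ∀ j : ℕ, x * q ^ j ≠ 1) :
    qPochInf x q ≠ 0 := by
  have := tprod_one_add_ne_zero_of_summable (f := fun j : ℕ => -(x * q ^ j))
    (fun j => by rw [← sub_eq_add_neg]; exact sub_ne_zero.2 (hx j).symm)
    (summable_norm_neg_mul_pow hq x)
  simpa only [qPochInf, sub_eq_add_neg] using this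

theorem qPochInf_ne_zero_of_norm_lt_one (hq : ‖q‖ < 1) {x : ℂ} (hx : ‖x‖ < 1) :
    qPochInf x q ≠ 0 := by
  refine qPochInf_ne_zero hq fun j h => ?_
  have h1 : ‖x * q ^ j‖ < 1 := by
    rw [norm_mul, norm_pow]
    exact mul_lt_one_of_nonneg_of_lt_one_left (norm_nonneg _) hx
      (pow_le_one₀ (norm_nonneg _) hq.le)
  rw [h, norm_one] at h1
  exact lt_irrefl _ h1

theorem qPoch_ne_zero (hq : ‖q‖ < 1) (k : ℕ) : qPoch q q k ≠ 0 := fun h =>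
  qPochInf_ne_zero_of_norm_lt_one hq hq (by rw [qPochInf_eq_qPoch_mul hq q k, h, zero_mul])

theorem qPoch_ne_zero_of_qPochInf_ne_zero (hq : ‖q‖ < 1) {x : ℂ} (hx : qPochInf x q ≠ 0)
    (k : ℕ) : qPoch x q k ≠ 0 := fun h =>
  hx (by rw [qPochInf_eq_qPoch_mul hq x k, h, zero_mul])

theorem hasProdLocallyUniformlyOn_qPochInf (hq : ‖q‖ < 1) (R : ℝ) :
    HasProdLocallyUniformlyOn (fun (j : ℕ) x => 1 - x * q ^ j) (fun x => qPochInf x q)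
      (Metric.ball (0 : ℂ) R) := by
  have := Summable.hasProdLocallyUniformlyOn_nat_one_add (K := Metric.ball (0 : ℂ) R)
    (f := fun (j : ℕ) x => -(x * q ^ j)) Metric.isOpen_ball
    (u := fun j => R * ‖q‖ ^ j)
    ((summable_geometric_of_lt_one (norm_nonneg _) hq).mul_left _)
    (.of_forall fun j x hx => by
      rw [norm_neg, norm_mul, norm_pow]
      gcongr
      exact (mem_ball_zero_iff.1 hx).le)
    (fun j => by fun_prop)
  simpa only [qPochInf, sub_eq_add_neg] using this

theorem differentiable_qPochInf (hq : ‖q‖ < 1) : Differentiable ℂ fun x => qPochInf x q := by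
  intro x
  have hx : x ∈ Metric.ball (0 : ℂ) (‖x‖ + 1) := by simp
  have := (hasProdLocallyUniformlyOn_qPochInf hq (‖x‖ + 1))
  have h2 : DifferentiableOn ℂ (fun x => qPochInf x q) (Metric.ball (0 : ℂ) (‖x‖ + 1)) :=
    TendstoLocallyUniformlyOn.differentiableOn this
      (.of_forall fun t => DifferentiableOn.fun_finsetProd fun i _ => by fun_prop)
      Metric.isOpen_ball
  exact h2.differentiableAt (Metric.isOpen_ball.mem_nhds hx)

theorem summable_pow_div_one_sub (hq : ‖q‖ < 1) {x : ℂ} (hx : ‖x‖ < 1) :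
    Summable fun j : ℕ => q ^ j / (1 - x * q ^ j) := by
  refine Summable.of_norm_bounded (g := fun j => ‖q‖ ^ j / (1 - ‖x‖))
    ((summable_geometric_of_lt_one (norm_nonneg _) hq).div_const _) fun j => ?_
  rw [norm_div, norm_pow]
  have h1 : 0 < 1 - ‖x‖ := sub_pos.2 hx
  have h2 : ‖x * q ^ j‖ ≤ ‖x‖ := by
    rw [norm_mul, norm_pow]
    exact mul_le_of_le_one_right (norm_nonneg _) (pow_le_one₀ (norm_nonneg _) hq.le)
  have h3 : 1 - ‖x‖ ≤ ‖1 - x * q ^ j‖ := by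
    have := norm_sub_norm_le (1 : ℂ) (x * q ^ j)
    rw [norm_one] at this
    linarith
  gcongr

theorem mul_deriv_qPochInf_eq_tsum (hq : ‖q‖ < 1) {x : ℂ} (hx : ‖x‖ < 1) :
    x * deriv (fun x => qPochInf x q) x =
      -(∑' j : ℕ, x * q ^ j / (1 - x * q ^ j)) * qPochInf x q := by
  have hP := qPochInf_ne_zero_of_norm_lt_one hq hx
  have hf : ∀ j : ℕ, 1 - x * q ^ j ≠ 0 := fun j h =>
    qPoch_ne_zero_of_qPochInf_ne_zero hq hP (j + 1) <| by
      rw [qPoch, Finset.prod_range_succ, h, mul_zero]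
  have hl : ∀ j : ℕ, logDeriv (fun x => 1 - x * q ^ j) x = -(q ^ j / (1 - x * q ^ j)) := by
    intro j
    have : HasDerivAt (fun x : ℂ => 1 - x * q ^ j) (-(1 * q ^ j)) x :=
      ((hasDerivAt_id' _).mul_const _).const_sub 1
    rw [logDeriv_apply, this.deriv, one_mul, neg_div]
  have hx1 : x ∈ Metric.ball (0 : ℂ) 1 := mem_ball_zero_iff.2 hx
  have key := logDeriv_tprod_eq_tsum (f := fun (j : ℕ) x => 1 - x * q ^ j) Metric.isOpen_ball
    hx1 hf (fun j => by fun_prop)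
    (by simp only [hl]; exact (summable_pow_div_one_sub hq hx).neg)
    (hasProdLocallyUniformlyOn_qPochInf hq 1).multipliableLocallyUniformlyOn hP
  simp only [hl, logDeriv_apply, tsum_neg] at key
  replace key : deriv (fun x => qPochInf x q) x / qPochInf x q = _ := key
  rw [div_eq_iff hP] at key
  have h2 : ∑' j : ℕ, x * q ^ j / (1 - x * q ^ j) = x * ∑' j : ℕ, q ^ j / (1 - x * q ^ j) := by
    rw [← tsum_mul_left]
    exact tsum_congr fun j => mul_div_assoc _ _ _
  rw [h2, key]
  ring

/-- The logarithmic derivative `x P'(x) / P(x)` of `P = (·; q)_∞` at `x = q^{m+1}`. -/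
theorem mul_deriv_qPochInf_pow (hq : ‖q‖ < 1) (m : ℕ) :
    q ^ (m + 1) * deriv (fun x => qPochInf x q) (q ^ (m + 1)) =
      (∑ l ∈ Finset.Icc 1 m, q ^ l / (1 - q ^ l) - ∑' j : ℕ, q ^ (j + 1) / (1 - q ^ (j + 1))) *
        qPochInf (q ^ (m + 1)) q := by
  have hx : ‖q ^ (m + 1)‖ < 1 := by
    rw [norm_pow]; exact pow_lt_one₀ (norm_nonneg _) hq m.succ_ne_zero
  have hs : Summable fun j : ℕ => q ^ (j + 1) / (1 - q ^ (j + 1)) := by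
    refine ((summable_pow_div_one_sub hq hq).mul_left q).congr fun j => ?_
    rw [pow_succ']; ring
  have h1 : ∑ l ∈ Finset.Icc 1 m, q ^ l / (1 - q ^ l) =
      ∑ l ∈ Finset.range m, q ^ (l + 1) / (1 - q ^ (l + 1)) := by
    induction m with
    | zero => simp
    | succ m ih =>
      rw [Finset.sum_Icc_succ_top (by omega), Finset.sum_range_succ, ih]
      rw [norm_pow]; exact pow_lt_one₀ (norm_nonneg _) hq m.succ_ne_zero
  have h2 : ∀ j : ℕ, q ^ (m + 1) * q ^ j = q ^ (j + m + 1) := fun j => by ring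
  rw [mul_deriv_qPochInf_eq_tsum hq hx, h1, ← hs.sum_add_tsum_nat_add m]
  simp only [h2]
  ring

/-- Only the factor `1 - x q^i` vanishes at `x = q^{-i}`, so the derivative is the product of the
others: the earlier factors, reversed, give `(q⁻¹; q⁻¹)_i`, and the tail gives `(q; q)_∞`. -/
theorem mul_deriv_qPochInf_inv_pow (hq : ‖q‖ < 1) (hq0 : q ≠ 0) (i : ℕ) :
    (q ^ i)⁻¹ * deriv (fun x => qPochInf x q) (q ^ i)⁻¹ =
      -(qPoch q⁻¹ q⁻¹ i * qPochInf q q) := by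
  have h1 : (fun x => qPochInf x q) =
      fun x => (1 - x * q ^ i) * (qPoch x q i * qPochInf (x * q ^ (i + 1)) q) := by
    ext x
    rw [qPochInf_eq_qPoch_mul hq x (i + 1), qPoch, qPoch, Finset.prod_range_succ]
    ring
  have hqi : q ^ i ≠ 0 := pow_ne_zero _ hq0
  have hd : DifferentiableAt ℂ (fun x => qPoch x q i * qPochInf (x * q ^ (i + 1)) q) (q ^ i)⁻¹ := by
    have h2 : Differentiable ℂ fun x => qPochInf (x * q ^ (i + 1)) q :=
      (differentiable_qPochInf hq).comp (by fun_prop : Differentiable ℂ fun x => x * q ^ (i + 1))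
    have h3 : Differentiable ℂ fun x => qPoch x q i := by unfold qPoch; fun_prop
    exact (h3.mul h2) _
  have h4 : HasDerivAt (fun x : ℂ => 1 - x * q ^ i) (-(1 * q ^ i)) (q ^ i)⁻¹ :=
    ((hasDerivAt_id' _).mul_const _).const_sub 1
  have h5 : qPoch (q ^ i)⁻¹ q i = qPoch q⁻¹ q⁻¹ i := by
    rw [qPoch, qPoch, ← Finset.prod_range_reflect]
    refine Finset.prod_congr rfl fun j hj => ?_
    have hj := Finset.mem_range.1 hj
    have : q ^ i = q ^ (j + 1) * q ^ (i - 1 - j) := by rw [← pow_add]; congr 1; omega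
    rw [this, inv_pow, pow_succ]
    field_simp
  rw [h1, (h4.fun_mul hd.hasDerivAt).deriv, inv_mul_cancel₀ hqi, h5, pow_succ,
    inv_mul_cancel_left₀ hqi]
  field_simp
  ring

end FigureEight

/-! ### The entire series F and its values and derivatives at powers of q -/

namespace FigureEight

/-- The coefficient `(-1)^k q^{k(k+1)/2} / (q; q)_k`. -/
noncomputable def blockCoeff (s : ℂ) (k : ℕ) : ℂ :=
  (-1) ^ k * s ^ (k * (k + 1)) / qPoch (s ^ 2) (s ^ 2) k

/-- The entire function `∑_k (-1)^k q^{k(k+1)/2} y^k (q^{k+1} y^2; q)_∞ / (q; q)_k`, which is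
`(q y^2; q)_∞` times the series in the definition of the holomorphic block. -/
noncomputable def blockSeries (s y : ℂ) : ℂ :=
  ∑' k : ℕ, blockCoeff s k * y ^ k * qPochInf ((s ^ 2) ^ (k + 1) * y ^ 2) (s ^ 2)

variable {s : ℂ}

theorem hasSum_of_eq {f g : ℕ → ℂ} {a : ℂ} (h : ∀ k, f k = g k) (hg : HasSum g a) :
    HasSum f a :=
  (funext h : f = g) ▸ hg

theorem norm_sq_lt_one (hs : ‖s‖ < 1) : ‖s ^ 2‖ < 1 := by
  rw [norm_pow]; exact pow_lt_one₀ (norm_nonneg _) hs two_ne_zero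

theorem summable_pow_mul_pow {r R : ℝ} (hr0 : 0 < r) (hr : r < 1) (hR : 0 < R) :
    Summable fun k : ℕ => r ^ (k * (k + 1)) * R ^ k := by
  refine summable_of_ratio_test_tendsto_lt_one zero_lt_one
    (.of_forall fun k => by positivity) ?_
  have h : ∀ k : ℕ, ‖r ^ ((k + 1) * (k + 1 + 1)) * R ^ (k + 1)‖ / ‖r ^ (k * (k + 1)) * R ^ k‖ =
      r ^ 2 * R * (r ^ 2) ^ k := by
    intro k
    rw [Real.norm_of_nonneg (by positivity), Real.norm_of_nonneg (by positivity),
      div_eq_iff (by positivity)]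
    ring
  simp only [h]
  simpa using (tendsto_pow_atTop_nhds_zero_of_lt_one (by positivity)
    (pow_lt_one₀ hr0.le hr two_ne_zero)).const_mul (r ^ 2 * R)

/-- The sequence converges, because `(q; q)_k` tends to the nonzero limit `(q; q)_∞`. -/
theorem exists_norm_inv_qPoch_le {q : ℂ} (hq : ‖q‖ < 1) : ∃ M, ∀ k, ‖(qPoch q q k)⁻¹‖ ≤ M := by
  have h := (multipliable_one_sub_mul_pow hq q).hasProd.tendsto_prod_nat
  obtain ⟨M, hM⟩ := (h.inv₀ (qPochInf_ne_zero_of_norm_lt_one hq hq)).norm.bddAbove_range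
  exact ⟨M, fun k => hM ⟨k, rfl⟩⟩

/-- Weierstrass majorant behind convergence, holomorphy and termwise differentiation of
`blockSeries`: the arguments of `P` stay in a fixed disc, where `P` is bounded, and the quadratic
exponent of `s` beats `R^k`. -/
theorem exists_summable_bound (hs0 : s ≠ 0) (hs : ‖s‖ < 1) (R : ℝ) (hR : 0 < R) :
    ∃ u : ℕ → ℝ, Summable u ∧ ∀ k : ℕ, ∀ w ∈ Metric.ball (0 : ℂ) R,
      ‖blockCoeff s k * w ^ k * qPochInf ((s ^ 2) ^ (k + 1) * w ^ 2) (s ^ 2)‖ ≤ u k := by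
  have hq := norm_sq_lt_one hs
  obtain ⟨M, hM⟩ := exists_norm_inv_qPoch_le hq
  obtain ⟨B, hB⟩ := (isCompact_closedBall (0 : ℂ) (R ^ 2)).exists_bound_of_continuousOn
    (differentiable_qPochInf hq).continuous.continuousOn
  refine ⟨fun k => M * B * (‖s‖ ^ (k * (k + 1)) * R ^ k),
    (summable_pow_mul_pow (norm_pos_iff.2 hs0) hs hR).mul_left _, fun k w hw => ?_⟩
  have hw' : ‖w‖ ≤ R := (mem_ball_zero_iff.1 hw).le
  have h1 : ‖qPochInf ((s ^ 2) ^ (k + 1) * w ^ 2) (s ^ 2)‖ ≤ B := by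
    refine hB _ (mem_closedBall_zero_iff.2 ?_)
    rw [norm_mul, norm_pow w]
    calc _ ≤ 1 * R ^ 2 := by
          gcongr
          rw [norm_pow]
          exact pow_le_one₀ (norm_nonneg _) hq.le
      _ = R ^ 2 := one_mul _
  have h2 : ‖blockCoeff s k‖ ≤ ‖s‖ ^ (k * (k + 1)) * M := by
    rw [blockCoeff, div_eq_mul_inv, norm_mul]
    simp only [norm_mul, norm_pow, norm_neg, norm_one, one_pow, one_mul]
    exact mul_le_mul_of_nonneg_left (hM k) (by positivity)
  calc _ ≤ ‖s‖ ^ (k * (k + 1)) * M * R ^ k * B := by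
        have hM0 : 0 ≤ M := (norm_nonneg _).trans (hM 0)
        rw [norm_mul, norm_mul, norm_pow]
        gcongr
    _ = _ := by ring

theorem differentiable_blockSeries_summand (hs : ‖s‖ < 1) (k : ℕ) : Differentiable ℂ fun y =>
    blockCoeff s k * y ^ k * qPochInf ((s ^ 2) ^ (k + 1) * y ^ 2) (s ^ 2) := by
  have h : Differentiable ℂ fun y => qPochInf ((s ^ 2) ^ (k + 1) * y ^ 2) (s ^ 2) :=
    (differentiable_qPochInf (norm_sq_lt_one hs)).comp
      (by fun_prop : Differentiable ℂ fun y => (s ^ 2) ^ (k + 1) * y ^ 2)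
  fun_prop

theorem differentiable_blockSeries (hs0 : s ≠ 0) (hs : ‖s‖ < 1) :
    Differentiable ℂ (blockSeries s) := by
  intro x
  obtain ⟨u, hu, h⟩ := exists_summable_bound hs0 hs (‖x‖ + 1) (by positivity)
  exact (Complex.differentiableOn_tsum_of_summable_norm hu
    (fun k => (differentiable_blockSeries_summand hs k).differentiableOn) Metric.isOpen_ball
    h).differentiableAt (Metric.isOpen_ball.mem_nhds (by simp))

theorem hasSum_blockSeries (hs0 : s ≠ 0) (hs : ‖s‖ < 1) (y : ℂ) :
    HasSum (fun k : ℕ => blockCoeff s k * y ^ k * qPochInf ((s ^ 2) ^ (k + 1) * y ^ 2) (s ^ 2))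
      (blockSeries s y) := by
  obtain ⟨u, hu, h⟩ := exists_summable_bound hs0 hs (‖y‖ + 1) (by positivity)
  exact (Summable.of_norm_bounded hu fun k => h k y (by simp)).hasSum

/-- The operator `y d/dy` multiplies `y^k` by `k` and acts on a function of `X = q^{k+1} y²` as `2 X
d/dX`. -/
theorem hasSum_mul_deriv_blockSeries (hs0 : s ≠ 0) (hs : ‖s‖ < 1) (y : ℂ) :
    HasSum (fun k : ℕ => blockCoeff s k * y ^ k *
        (k * qPochInf ((s ^ 2) ^ (k + 1) * y ^ 2) (s ^ 2) +
          2 * ((s ^ 2) ^ (k + 1) * y ^ 2 *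
            deriv (fun x => qPochInf x (s ^ 2)) ((s ^ 2) ^ (k + 1) * y ^ 2))))
      (y * deriv (blockSeries s) y) := by
  obtain ⟨u, hu, h⟩ := exists_summable_bound hs0 hs (‖y‖ + 1) (by positivity)
  have := (Complex.hasSum_deriv_of_summable_norm (z := y) hu
    (fun k => (differentiable_blockSeries_summand hs k).differentiableOn) Metric.isOpen_ball
    h (by simp)).mul_left y
  refine hasSum_of_eq (fun k => ?_) this
  have hX : HasDerivAt (fun y : ℂ => (s ^ 2) ^ (k + 1) * y ^ 2) ((s ^ 2) ^ (k + 1) * (2 * y)) y := by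
    simpa using (hasDerivAt_pow 2 y).const_mul ((s ^ 2) ^ (k + 1))
  have hP := ((differentiable_qPochInf (norm_sq_lt_one hs))
    ((s ^ 2) ^ (k + 1) * y ^ 2)).hasDerivAt.comp y hX
  have hy : HasDerivAt (fun y : ℂ => blockCoeff s k * y ^ k)
    (blockCoeff s k * (k * y ^ (k - 1))) y := (hasDerivAt_pow k y).const_mul _
  have hk : (k : ℂ) * y ^ k = y * (k * y ^ (k - 1)) := by
    cases k with
    | zero => simp
    | succ k => rw [Nat.add_sub_cancel]; ring
  have := (hy.fun_mul hP).deriv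
  simp only [Function.comp_apply] at this
  rw [this]
  linear_combination blockCoeff s k * qPochInf ((s ^ 2) ^ (k + 1) * y ^ 2) (s ^ 2) * hk

/-- The value of the logarithmic derivative of `(·; q)_∞` at `q^{m+1}`. -/
noncomputable def logDerivCoeff (q : ℂ) (m : ℕ) : ℂ :=
  ∑ l ∈ Finset.Icc 1 m, q ^ l / (1 - q ^ l) - ∑' j : ℕ, q ^ (j + 1) / (1 - q ^ (j + 1))

/-- Uses `(1 + q^l)/(1 - q^l) = 1 + 2 q^l/(1 - q^l)`; the `1/2` offsets the constant `ζ(0)/2 = -1/4`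
of `E₁`. -/
theorem natCast_add_two_mul_logDerivCoeff {q : ℂ} (hq : ‖q‖ < 1) (m : ℕ) :
    m + 2 * logDerivCoeff q m = qHarm q m - 2 * E 1 q - 1 / 2 := by
  have h1 : ∀ l ∈ Finset.Icc 1 m, (1 + q ^ l) / (1 - q ^ l) = 1 + 2 * (q ^ l / (1 - q ^ l)) := by
    intro l hl
    have hl := (Finset.mem_Icc.1 hl).1
    have h : 1 - q ^ l ≠ 0 := fun h => by
      have h2 : ‖q ^ l‖ < 1 := by
        rw [norm_pow]; exact pow_lt_one₀ (norm_nonneg _) hq (by omega)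
      rw [← sub_eq_zero.1 h, norm_one] at h2
      exact lt_irrefl _ h2
    field_simp
    ring
  rw [qHarm, Finset.sum_congr rfl h1, Finset.sum_add_distrib, ← Finset.mul_sum, logDerivCoeff, E,
    if_pos hq, eisensteinSeries]
  simp [riemannZeta_zero]
  ring

theorem blockCoeff_mul_qPochInf (hs : ‖s‖ < 1) (m k : ℕ) :
    blockCoeff s k * ((s ^ 2) ^ m) ^ k * qPochInf ((s ^ 2) ^ (k + 2 * m + 1)) (s ^ 2) =
      term s m k * qPochInf (s ^ 2) (s ^ 2) := by
  have hq := norm_sq_lt_one hs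
  have h1 := qPoch_ne_zero hq k
  have h2 := qPoch_ne_zero hq (k + 2 * m)
  rw [qPochInf_eq_qPoch_mul hq (s ^ 2) (k + 2 * m), ← pow_succ', blockCoeff, term, pow_add s]
  field_simp
  ring

/-- The shift `k = j + 2m` turns the terms of `F` at `q^{-m}` into `q^m` times those at `q^m`, by
completing the square in the exponent. -/
theorem blockCoeff_add_mul_qPochInf (hs0 : s ≠ 0) (hs : ‖s‖ < 1) (m j : ℕ) :
    blockCoeff s (j + 2 * m) * ((s ^ 2) ^ m)⁻¹ ^ (j + 2 * m) *
        qPochInf ((s ^ 2) ^ (j + 1)) (s ^ 2) =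
      (s ^ 2) ^ m * (term s m j * qPochInf (s ^ 2) (s ^ 2)) := by
  have hq := norm_sq_lt_one hs
  have h1 := qPoch_ne_zero hq j
  have h2 := qPoch_ne_zero hq (j + 2 * m)
  have h3 : s ^ ((j + 2 * m) * (j + 2 * m + 1)) * ((s ^ 2) ^ m)⁻¹ ^ (j + 2 * m) =
      (s ^ 2) ^ m * s ^ (j * (j + 1) + 2 * m * j) := by
    rw [inv_pow, ← div_eq_mul_inv, div_eq_iff (by positivity)]
    simp only [← pow_mul, ← pow_add]
    congr 1
    ring
  rw [qPochInf_eq_qPoch_mul hq (s ^ 2) j, ← pow_succ', blockCoeff, term, div_mul_eq_mul_div,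
    mul_assoc ((-1) ^ (j + 2 * m)), h3, pow_add, pow_mul]
  field_simp
  ring

theorem pow_succ_mul_sq (q : ℂ) (m k : ℕ) : q ^ (k + 1) * (q ^ m) ^ 2 = q ^ (k + 2 * m + 1) := by
  ring

theorem pow_succ_mul_inv_sq {q : ℂ} (hq : q ≠ 0) (m j : ℕ) :
    q ^ (j + 2 * m + 1) * ((q ^ m)⁻¹) ^ 2 = q ^ (j + 1) := by
  field_simp
  ring

theorem pow_succ_mul_inv_sq_of_lt {q : ℂ} (hq : q ≠ 0) {m k : ℕ} (hk : k < 2 * m) :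
    q ^ (k + 1) * ((q ^ m)⁻¹) ^ 2 = (q ^ (2 * m - 1 - k))⁻¹ := by
  have h : (q ^ m) ^ 2 = q ^ (k + 1) * q ^ (2 * m - 1 - k) := by
    rw [← pow_mul, ← pow_add]; congr 1; omega
  rw [inv_pow, h]
  field_simp

theorem qPochInf_inv_pow {q : ℂ} (hq : ‖q‖ < 1) (hq0 : q ≠ 0) (i : ℕ) :
    qPochInf (q ^ i)⁻¹ q = 0 := by
  rw [qPochInf_eq_qPoch_mul hq _ (i + 1), qPoch, Finset.prod_range_succ,
    inv_mul_cancel₀ (pow_ne_zero _ hq0)]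
  simp

theorem hasSum_term (hs0 : s ≠ 0) (hs : ‖s‖ < 1) (m : ℕ) :
    HasSum (fun k => term s m k * qPochInf (s ^ 2) (s ^ 2)) (blockSeries s ((s ^ 2) ^ m)) := by
  have := hasSum_blockSeries hs0 hs ((s ^ 2) ^ m)
  simpa only [pow_succ_mul_sq, blockCoeff_mul_qPochInf hs] using this

theorem blockSeries_inv_pow (hs0 : s ≠ 0) (hs : ‖s‖ < 1) (m : ℕ) :
    blockSeries s ((s ^ 2) ^ m)⁻¹ = (s ^ 2) ^ m * blockSeries s ((s ^ 2) ^ m) := by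
  have hq := norm_sq_lt_one hs
  have hq0 : s ^ 2 ≠ 0 := pow_ne_zero _ hs0
  have h1 := (hasSum_nat_add_iff' (2 * m)).2 (hasSum_blockSeries hs0 hs ((s ^ 2) ^ m)⁻¹)
  simp only [pow_succ_mul_inv_sq hq0, blockCoeff_add_mul_qPochInf hs0 hs] at h1
  rw [Finset.sum_eq_zero, sub_zero] at h1
  · exact h1.unique ((hasSum_term hs0 hs m).mul_left _)
  -- For `k < 2m` the argument of `P` is `q^{-i}` with `i = 2m - 1 - k ≥ 0`, a zero of `P`.
  · intro k hk
    rw [pow_succ_mul_inv_sq_of_lt hq0 (Finset.mem_range.1 hk), qPochInf_inv_pow hq hq0, mul_zero]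

theorem hasSum_deriv_pow (hs0 : s ≠ 0) (hs : ‖s‖ < 1) (m : ℕ) :
    HasSum (fun k : ℕ => (k + 2 * logDerivCoeff (s ^ 2) (k + 2 * m)) *
        (term s m k * qPochInf (s ^ 2) (s ^ 2)))
      ((s ^ 2) ^ m * deriv (blockSeries s) ((s ^ 2) ^ m)) := by
  have hq := norm_sq_lt_one hs
  have := hasSum_mul_deriv_blockSeries hs0 hs ((s ^ 2) ^ m)
  simp only [pow_succ_mul_sq, mul_deriv_qPochInf_pow hq] at this
  refine hasSum_of_eq (fun k => ?_) this
  rw [← blockCoeff_mul_qPochInf hs, logDerivCoeff]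
  ring

/-- The first `2m` terms of `F` vanish at `q^{-m}` but their derivatives do not: they are the source
of the finite sum in `h⁽¹⁾`, here moved to the side of the value. -/
theorem hasSum_deriv_inv_pow (hs0 : s ≠ 0) (hs : ‖s‖ < 1) (m : ℕ) :
    HasSum (fun k : ℕ => (k + 2 * m + 2 * logDerivCoeff (s ^ 2) k) *
        ((s ^ 2) ^ m * (term s m k * qPochInf (s ^ 2) (s ^ 2))))
      (((s ^ 2) ^ m)⁻¹ * deriv (blockSeries s) ((s ^ 2) ^ m)⁻¹ +
        2 * (∑ k ∈ Finset.range (2 * m), blockCoeff s k * ((s ^ 2) ^ m)⁻¹ ^ k *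
          qPoch (s ^ 2)⁻¹ (s ^ 2)⁻¹ (2 * m - 1 - k)) * qPochInf (s ^ 2) (s ^ 2)) := by
  have hq := norm_sq_lt_one hs
  have hq0 : s ^ 2 ≠ 0 := pow_ne_zero _ hs0
  have h1 := (hasSum_nat_add_iff' (2 * m)).2 (hasSum_mul_deriv_blockSeries hs0 hs ((s ^ 2) ^ m)⁻¹)
  simp only [pow_succ_mul_inv_sq hq0, mul_deriv_qPochInf_pow hq] at h1
  convert hasSum_of_eq (fun k => ?_) h1 using 1
  rotate_left
  · rw [← blockCoeff_add_mul_qPochInf hs0 hs, logDerivCoeff]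
    push_cast
    ring
  · rw [sub_eq_add_neg, ← Finset.sum_neg_distrib, Finset.mul_sum, Finset.sum_mul]
    congr 1
    refine Finset.sum_congr rfl fun k hk => ?_
    rw [pow_succ_mul_inv_sq_of_lt hq0 (Finset.mem_range.1 hk), qPochInf_inv_pow hq hq0,
      mul_deriv_qPochInf_inv_pow hq hq0]
    ring

end FigureEight

namespace FigureEight

/-! ### Quotients of entire functions at a simple zero -/

section Expansion

variable {N D : ℂ → ℂ} {w d : ℂ}

/-- `dslope D 0` is the entire function `D u / u` with value `d ≠ 0` at the origin, so the quotient
is differentiable there. The three expansions below reduce to this one. -/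
theorem isBigO_div_dslope_sub (hN : Differentiable ℂ N) (hD : Differentiable ℂ D)
    (hd : HasDerivAt D d 0) (hd0 : d ≠ 0) :
    (fun u => N u / dslope D 0 u - N 0 / d) =O[𝓝[≠] 0] fun u => u := by
  have hE : Differentiable ℂ (dslope D 0) := by
    rw [← differentiableOn_univ] at hD ⊢
    exact (Complex.differentiableOn_dslope univ_mem).2 hD
  have hE0 : dslope D 0 0 = d := by rw [dslope_same, hd.deriv]
  have h := ((hN 0).fun_div (hE 0) (by rwa [hE0])).isBigO_sub
  simp only [hE0, sub_zero] at h
  exact h.mono nhdsWithin_le_nhds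

theorem dslope_zero_of_ne (hD0 : D 0 = 0) {u : ℂ} (hu : u ≠ 0) : dslope D 0 u = D u / u := by
  rw [dslope_of_ne _ hu, slope_def_field, hD0, sub_zero, sub_zero]

theorem isBigO_div_sub_pole (hN : Differentiable ℂ N) (hD : Differentiable ℂ D) (hD0 : D 0 = 0)
    (hd : HasDerivAt D d 0) (hd0 : d ≠ 0) :
    (fun u => N u / D u - N 0 / d * u⁻¹) =O[𝓝[≠] 0] fun _ => (1 : ℂ) := by
  refine ((isBigO_div_dslope_sub hN hD hd hd0).mul
    (isBigO_refl (fun u : ℂ => u⁻¹) (𝓝[≠] 0))).congr' ?_ ?_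
  · filter_upwards [self_mem_nhdsWithin] with u hu
    have hu : u ≠ 0 := hu
    rw [dslope_zero_of_ne hD0 hu, sub_mul, div_div_eq_mul_div, div_mul_eq_mul_div,
      mul_inv_cancel_right₀ hu]
  · filter_upwards [self_mem_nhdsWithin] with u hu
    exact mul_inv_cancel₀ hu

theorem isBigO_div_sub_const (hN : Differentiable ℂ N) (hN0 : N 0 = 0) (hw : HasDerivAt N w 0)
    (hD : Differentiable ℂ D) (hD0 : D 0 = 0) (hd : HasDerivAt D d 0) (hd0 : d ≠ 0) :
    (fun u => N u / D u - w / d) =O[𝓝[≠] 0] fun u => u := by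
  have hE : Differentiable ℂ (dslope N 0) := by
    rw [← differentiableOn_univ] at hN ⊢
    exact (Complex.differentiableOn_dslope univ_mem).2 hN
  have h := isBigO_div_dslope_sub hE hD hd hd0
  rw [dslope_same, hw.deriv] at h
  refine h.congr' ?_ .rfl
  filter_upwards [self_mem_nhdsWithin] with u hu
  rw [dslope_zero_of_ne hD0 hu, dslope_zero_of_ne hN0 hu, div_div_div_cancel_right₀ hu]

theorem isBigO_mul_div_sub_linear {A : ℂ → ℂ} {a : ℂ} (hA : Differentiable ℂ A) (hA0 : A 0 = 0)
    (ha : HasDerivAt A a 0) (hN : Differentiable ℂ N) (hN0 : N 0 = 0) (hw : HasDerivAt N w 0)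
    (hD : Differentiable ℂ D) (hD0 : D 0 = 0) (hd : HasDerivAt D d 0) (hd0 : d ≠ 0) :
    (fun u => A u * N u / D u - a * w / d * u) =O[𝓝[≠] 0] fun u => u ^ 2 := by
  have hE : Differentiable ℂ (dslope N 0) := by
    rw [← differentiableOn_univ] at hN ⊢
    exact (Complex.differentiableOn_dslope univ_mem).2 hN
  have hAE : HasDerivAt (fun u => A u * dslope N 0 u) (a * w) 0 := by
    simpa [hA0, dslope_same, hw.deriv] using ha.fun_mul (hE 0).hasDerivAt
  have h := (isBigO_div_sub_const (hA.fun_mul hE) (by rw [hA0, zero_mul]) hAE hD hD0 hd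
    hd0).mul (isBigO_refl (fun u : ℂ => u) (𝓝[≠] 0))
  refine h.congr' ?_ (.of_forall fun u => (sq u).symm)
  filter_upwards [self_mem_nhdsWithin] with u hu
  have hu : u ≠ 0 := hu
  rw [dslope_zero_of_ne hN0 hu]
  field_simp

end Expansion

/-! ### Theta functions: quasi-periodicity and derivatives at powers of q -/

section Theta

/-- The function `θ(-q^{1/2} y; q) = (q y; q)_∞ (y⁻¹; q)_∞`. -/
noncomputable def thetaShift (s y : ℂ) : ℂ := qPochInf (s ^ 2 * y) (s ^ 2) * qPochInf y⁻¹ (s ^ 2)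

variable {s : ℂ}

theorem theta_neg_mul (hs0 : s ≠ 0) (x : ℂ) : theta s (-s * x) = thetaShift s x := by
  rw [theta, thetaShift]
  congr 2
  · ring
  · rw [mul_inv, mul_inv_cancel_left₀ (neg_ne_zero.2 hs0)]

theorem theta_inv (s x : ℂ) : theta s x⁻¹ = theta s x := by
  rw [theta, theta, inv_inv, mul_comm]

theorem theta_neg_inv_mul (hs0 : s ≠ 0) (x : ℂ) : theta s (-s⁻¹ * x) = thetaShift s x⁻¹ := by
  rw [← theta_neg_mul hs0, ← theta_inv, mul_inv, inv_neg, inv_inv]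

theorem thetaShift_inv (hs : ‖s‖ < 1) {y : ℂ} (hy : y ≠ 0) :
    thetaShift s y⁻¹ = -y * thetaShift s y := by
  have hq := norm_sq_lt_one hs
  rw [thetaShift, thetaShift, inv_inv, qPochInf_eq_mul hq y, qPochInf_eq_mul hq y⁻¹,
    mul_comm y (s ^ 2), mul_comm y⁻¹ (s ^ 2)]
  field_simp
  ring

theorem thetaShift_sq_mul (hs0 : s ≠ 0) (hs : ‖s‖ < 1) {y : ℂ} (hy : y ≠ 0) :
    thetaShift s (s ^ 2 * y) = -(s ^ 2 * y)⁻¹ * thetaShift s y := by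
  have hq := norm_sq_lt_one hs
  have h : (s ^ 2 * y)⁻¹ * s ^ 2 = y⁻¹ := by field_simp
  rw [thetaShift, thetaShift, qPochInf_eq_mul hq (s ^ 2 * y), qPochInf_eq_mul hq (s ^ 2 * y)⁻¹,
    h, mul_comm (s ^ 2 * y) (s ^ 2)]
  field_simp
  ring

theorem theta_sq_mul (hs0 : s ≠ 0) (hs : ‖s‖ < 1) {y : ℂ} (hy : y ≠ 0) :
    theta s (s ^ 2 * y) = (s * y)⁻¹ * theta s y := by
  have hq := norm_sq_lt_one hs
  have h1 : -s * (s ^ 2 * y)⁻¹ * s ^ 2 = -s * y⁻¹ := by field_simp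
  have h2 : -s * y * s ^ 2 = -s * (s ^ 2 * y) := by ring
  rw [theta, theta, qPochInf_eq_mul hq (-s * y), qPochInf_eq_mul hq (-s * (s ^ 2 * y)⁻¹), h1, h2]
  field_simp
  ring

/-- Nonvanishing of `a` allows the recurrence to be run backwards to negative integers. -/
theorem eq_of_int_recurrence {g c a : ℤ → ℂ} (ha : ∀ m, a m ≠ 0)
    (hg : ∀ m, g (m + 1) = a m * g m) (hc : ∀ m, c (m + 1) = a m * c m) (h0 : g 0 = c 0)
    (m : ℤ) : g m = c m := by
  induction m using Int.induction_on with
  | zero => exact h0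
  | succ i ih => rw [hg, hc, ih]
  | pred i ih =>
    have h1 := hg (-i - 1)
    have h2 := hc (-i - 1)
    rw [sub_add_cancel] at h1 h2
    exact mul_left_cancel₀ (ha (-i - 1)) (by rw [← h1, ← h2, ih])

theorem thetaShift_zpow_mul (hs0 : s ≠ 0) (hs : ‖s‖ < 1) {y : ℂ} (hy : y ≠ 0) (m : ℤ) :
    thetaShift s ((s ^ 2) ^ m * y) =
      (-1) ^ m * s ^ (-(m * (m + 1))) * y ^ (-m) * thetaShift s y := by
  have hq0 : s ^ 2 ≠ 0 := pow_ne_zero _ hs0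
  refine eq_of_int_recurrence (g := fun m => thetaShift s ((s ^ 2) ^ m * y))
    (c := fun m => (-1) ^ m * s ^ (-(m * (m + 1))) * y ^ (-m) * thetaShift s y)
    (a := fun m => -(s ^ 2 * ((s ^ 2) ^ m * y))⁻¹) (fun m => ?_) (fun m => ?_) (fun m => ?_)
    (by simp) m
  · exact neg_ne_zero.2
      (inv_ne_zero (mul_ne_zero hq0 (mul_ne_zero (zpow_ne_zero m hq0) hy)))
  · rw [← thetaShift_sq_mul hs0 hs (mul_ne_zero (zpow_ne_zero m hq0) hy), zpow_add_one₀ hq0]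
    ring_nf
  · have h1 : s ^ (-((m + 1) * (m + 1 + 1))) = s ^ (-(m * (m + 1))) * (s ^ 2 * (s ^ 2) ^ m)⁻¹ := by
      rw [← zpow_natCast s 2, ← zpow_mul, ← zpow_add₀ hs0, ← zpow_neg, ← zpow_add₀ hs0]
      congr 1
      push_cast
      ring
    have h2 : y ^ (-(m + 1)) = y ^ (-m) * y⁻¹ := by
      rw [neg_add, zpow_add₀ hy, zpow_neg_one]
    rw [h1, h2, zpow_add_one₀ (by norm_num : (-1 : ℂ) ≠ 0)]
    simp only [mul_inv]
    ring

theorem theta_zpow_mul (hs0 : s ≠ 0) (hs : ‖s‖ < 1) {y : ℂ} (hy : y ≠ 0) (m : ℤ) :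
    theta s ((s ^ 2) ^ m * y) = s ^ (-(m * m)) * y ^ (-m) * theta s y := by
  have hq0 : s ^ 2 ≠ 0 := pow_ne_zero _ hs0
  refine eq_of_int_recurrence (g := fun m => theta s ((s ^ 2) ^ m * y))
    (c := fun m => s ^ (-(m * m)) * y ^ (-m) * theta s y)
    (a := fun m => (s * ((s ^ 2) ^ m * y))⁻¹) (fun m => ?_) (fun m => ?_) (fun m => ?_)
    (by simp) m
  · exact inv_ne_zero (mul_ne_zero hs0 (mul_ne_zero (zpow_ne_zero m hq0) hy))
  · rw [← theta_sq_mul hs0 hs (mul_ne_zero (zpow_ne_zero m hq0) hy), zpow_add_one₀ hq0]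
    ring_nf
  · have h1 : s ^ (-((m + 1) * (m + 1))) = s ^ (-(m * m)) * (s * (s ^ 2) ^ m)⁻¹ := by
      rw [← zpow_natCast s 2, ← zpow_mul, ← zpow_one_add₀ hs0, ← zpow_neg, ← zpow_add₀ hs0]
      congr 1
      push_cast
      ring
    have h2 : y ^ (-(m + 1)) = y ^ (-m) * y⁻¹ := by
      rw [neg_add, zpow_add₀ hy, zpow_neg_one]
    rw [h1, h2]
    simp only [mul_inv]
    ring

theorem pt_ne_zero (hs0 : s ≠ 0) (n : ℤ) (u : ℂ) : pt s n u ≠ 0 :=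
  mul_ne_zero (zpow_ne_zero _ (pow_ne_zero _ hs0)) (Complex.exp_ne_zero _)

theorem differentiable_pt (s : ℂ) (n : ℤ) : Differentiable ℂ (pt s n) := by
  unfold pt; fun_prop

theorem pt_zero (s : ℂ) (n : ℤ) : pt s n 0 = (s ^ 2) ^ n := by simp [pt]

theorem hasDerivAt_pt (s : ℂ) (n : ℤ) (u : ℂ) : HasDerivAt (pt s n) (pt s n u) u :=
  (Complex.hasDerivAt_exp u).const_mul _

theorem hasDerivAt_inv_pt (hs0 : s ≠ 0) (n : ℤ) (u : ℂ) :
    HasDerivAt (fun u => (pt s n u)⁻¹) (-(pt s n u)⁻¹) u := by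
  have h := pt_ne_zero hs0 n u
  exact ((hasDerivAt_pt s n u).fun_inv h).congr_deriv (by field_simp)

theorem differentiable_inv_pt (hs0 : s ≠ 0) (n : ℤ) : Differentiable ℂ fun u => (pt s n u)⁻¹ :=
  fun u => (hasDerivAt_inv_pt hs0 n u).differentiableAt

theorem inv_pt_inv (s : ℂ) (n : ℤ) (u : ℂ) : (pt s⁻¹ n u)⁻¹ = pt s n (-u) := by
  rw [pt, pt, Complex.exp_neg, mul_inv, inv_pow, inv_zpow, inv_inv]

/-- The zero comes from the factor `1 - e^{-cu}` of `(e^{-cu}; q)_∞`; the remaining factors equal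
`(q; q)_∞²` at `u = 0`. -/
theorem hasDerivAt_thetaShift_exp (hs : ‖s‖ < 1) (c : ℂ) :
    HasDerivAt (fun u => thetaShift s (Complex.exp (c * u))) (c * qPochInf (s ^ 2) (s ^ 2) ^ 2)
      0 := by
  have hq := norm_sq_lt_one hs
  have hP := differentiable_qPochInf hq
  have h1 : (fun u => thetaShift s (Complex.exp (c * u))) = fun u =>
      (1 - Complex.exp (-(c * u))) * (qPochInf (s ^ 2 * Complex.exp (c * u)) (s ^ 2) *
        qPochInf (Complex.exp (-(c * u)) * s ^ 2) (s ^ 2)) := by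
    ext u
    rw [thetaShift, qPochInf_eq_mul hq (Complex.exp (c * u))⁻¹, Complex.exp_neg]
    ring
  have h2 : HasDerivAt (fun u : ℂ => 1 - Complex.exp (-(c * u))) c 0 := by
    simpa using (((hasDerivAt_id' (0 : ℂ)).const_mul c).fun_neg.cexp).const_sub 1
  have h3 : Differentiable ℂ fun u => qPochInf (s ^ 2 * Complex.exp (c * u)) (s ^ 2) :=
    hP.comp (by fun_prop : Differentiable ℂ fun u => s ^ 2 * Complex.exp (c * u))
  have h4 : Differentiable ℂ fun u => qPochInf (Complex.exp (-(c * u)) * s ^ 2) (s ^ 2) :=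
    hP.comp (by fun_prop : Differentiable ℂ fun u => Complex.exp (-(c * u)) * s ^ 2)
  rw [h1]
  simpa [sq] using h2.fun_mul ((h3.fun_mul h4) 0).hasDerivAt

/-- The denominator `θ(y; q) θ(-q^{1/2} y; q)` of the holomorphic block. -/
noncomputable def blockDenom (s y : ℂ) : ℂ := theta s y * thetaShift s y

theorem blockDenom_inv (hs : ‖s‖ < 1) {y : ℂ} (hy : y ≠ 0) :
    blockDenom s y⁻¹ = -y * blockDenom s y := by
  rw [blockDenom, blockDenom, thetaShift_inv hs hy, theta_inv]
  ring

theorem differentiable_theta_pt (hs0 : s ≠ 0) (hs : ‖s‖ < 1) (n : ℤ) :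
    Differentiable ℂ fun u => theta s (pt s n u) := by
  have hP := differentiable_qPochInf (norm_sq_lt_one hs)
  exact (hP.comp ((differentiable_pt s n).const_mul (-s))).fun_mul
    (hP.comp ((differentiable_inv_pt hs0 n).const_mul (-s)))

theorem differentiable_thetaShift_pt (hs0 : s ≠ 0) (hs : ‖s‖ < 1) (n : ℤ) :
    Differentiable ℂ fun u => thetaShift s (pt s n u) := by
  have hP := differentiable_qPochInf (norm_sq_lt_one hs)
  exact (hP.comp ((differentiable_pt s n).const_mul (s ^ 2))).fun_mul
    (hP.comp (differentiable_inv_pt hs0 n))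

theorem differentiable_blockDenom_pt (hs0 : s ≠ 0) (hs : ‖s‖ < 1) (n : ℤ) :
    Differentiable ℂ fun u => blockDenom s (pt s n u) :=
  (differentiable_theta_pt hs0 hs n).fun_mul (differentiable_thetaShift_pt hs0 hs n)

theorem pt_sq (s : ℂ) (n : ℤ) (u : ℂ) : pt s n u ^ 2 = pt s (2 * n) (2 * u) := by
  rw [pt, pt, mul_pow, ← Complex.exp_nat_mul, mul_comm 2 n, zpow_mul]
  norm_cast

theorem thetaShift_pt (hs0 : s ≠ 0) (hs : ‖s‖ < 1) (n : ℤ) (u : ℂ) :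
    thetaShift s (pt s n u) =
      (-1) ^ n * s ^ (-(n * (n + 1))) * Complex.exp (-(n * u)) * thetaShift s (Complex.exp u) := by
  rw [pt, thetaShift_zpow_mul hs0 hs (Complex.exp_ne_zero u), ← Complex.exp_int_mul]
  push_cast
  rw [neg_mul]

theorem thetaShift_one (hs : ‖s‖ < 1) : thetaShift s 1 = 0 := by
  rw [thetaShift, inv_one, qPochInf_eq_mul (norm_sq_lt_one hs) 1, sub_self, zero_mul, mul_zero]

theorem hasDerivAt_thetaShift_pt (hs0 : s ≠ 0) (hs : ‖s‖ < 1) (n : ℤ) (c : ℂ) :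
    HasDerivAt (fun u => thetaShift s (pt s n (c * u)))
      ((-1) ^ n * s ^ (-(n * (n + 1))) * (c * qPochInf (s ^ 2) (s ^ 2) ^ 2)) 0 := by
  have h1 : DifferentiableAt ℂ (fun u : ℂ =>
    (-1) ^ n * s ^ (-(n * (n + 1))) * Complex.exp (-(n * (c * u)))) 0 := by fun_prop
  have := h1.hasDerivAt.fun_mul (hasDerivAt_thetaShift_exp hs c)
  simp only [thetaShift_pt hs0 hs]
  simpa [thetaShift_one hs] using this

theorem thetaShift_pt_zero (hs0 : s ≠ 0) (hs : ‖s‖ < 1) (n : ℤ) :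
    thetaShift s (pt s n 0) = 0 := by
  rw [thetaShift_pt hs0 hs, Complex.exp_zero, thetaShift_one hs, mul_zero]

theorem theta_pt_zero (hs0 : s ≠ 0) (hs : ‖s‖ < 1) (n : ℤ) :
    theta s (pt s n 0) = s ^ (-(n * n)) * qPochInf (-s) (s ^ 2) ^ 2 := by
  rw [pt, theta_zpow_mul hs0 hs (Complex.exp_ne_zero 0), Complex.exp_zero, one_zpow, theta]
  simp [sq]

theorem hasDerivAt_blockDenom_pt (hs0 : s ≠ 0) (hs : ‖s‖ < 1) (n : ℤ) :
    HasDerivAt (fun u => blockDenom s (pt s n u))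
      ((-1) ^ n * s ^ (-(n * (2 * n + 1))) * (qPochInf (s ^ 2) (s ^ 2) * normFactor s)) 0 := by
  have h0 := hasDerivAt_thetaShift_pt hs0 hs n 1
  simp only [one_mul] at h0
  have h1 := (differentiable_theta_pt hs0 hs n 0).hasDerivAt.fun_mul h0
  -- Since `thetaShift` vanishes here, only the term of the product rule that differentiates it
  -- survives.
  rw [thetaShift_pt_zero hs0 hs, theta_pt_zero hs0 hs] at h1
  refine h1.congr_deriv ?_
  have : s ^ (-(n * (2 * n + 1))) = s ^ (-(n * n)) * s ^ (-(n * (n + 1))) := by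
    rw [← zpow_add₀ hs0]; congr 1; ring
  rw [this, normFactor]
  ring

theorem blockDenom_pt_zero (hs0 : s ≠ 0) (hs : ‖s‖ < 1) (n : ℤ) :
    blockDenom s (pt s n 0) = 0 := by
  rw [blockDenom, thetaShift_pt_zero hs0 hs, mul_zero]

theorem hasDerivAt_thetaShift_pt_sq (hs0 : s ≠ 0) (hs : ‖s‖ < 1) (n : ℤ) :
    HasDerivAt (fun u => thetaShift s (pt s n u ^ 2))
      (s ^ (-(2 * n * (2 * n + 1))) * (2 * qPochInf (s ^ 2) (s ^ 2) ^ 2)) 0 := by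
  have h := hasDerivAt_thetaShift_pt hs0 hs (2 * n) 2
  rw [(even_two_mul n).neg_one_zpow, one_mul] at h
  simpa only [pt_sq] using h

theorem differentiable_thetaShift_pt_sq (hs0 : s ≠ 0) (hs : ‖s‖ < 1) (n : ℤ) :
    Differentiable ℂ fun u => thetaShift s (pt s n u ^ 2) := by
  simp only [pt_sq]
  exact (differentiable_thetaShift_pt hs0 hs (2 * n)).comp (differentiable_id.const_mul 2)

theorem thetaShift_pt_sq_zero (hs0 : s ≠ 0) (hs : ‖s‖ < 1) (n : ℤ) :
    thetaShift s (pt s n 0 ^ 2) = 0 := by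
  rw [pt_sq, mul_zero, thetaShift_pt_zero hs0 hs]

theorem normFactor_ne_zero (hs : ‖s‖ < 1) : normFactor s ≠ 0 := by
  have hq := norm_sq_lt_one hs
  exact mul_ne_zero (qPochInf_ne_zero_of_norm_lt_one hq hq)
    (pow_ne_zero _ (qPochInf_ne_zero_of_norm_lt_one hq (by rwa [norm_neg])))

end Theta

end FigureEight

/-! ### Limits read off from expansions -/

namespace FigureEight

section Limits

variable {f : ℂ → ℂ} {a : ℂ}

theorem tendsto_of_isBigO_const (h : (fun u => f u - a) =O[𝓝[≠] 0] fun u => u) :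
    Tendsto f (𝓝[≠] 0) (𝓝 a) := by
  have := h.trans_tendsto (tendsto_id.mono_left nhdsWithin_le_nhds)
  simpa using this.add_const a

theorem tendsto_mul_of_isBigO_pole
    (h : (fun u => f u - a * u⁻¹) =O[𝓝[≠] 0] fun _ => (1 : ℂ)) :
    Tendsto (fun u => u * f u) (𝓝[≠] 0) (𝓝 a) := by
  refine tendsto_of_isBigO_const (((isBigO_refl (fun u : ℂ => u) (𝓝[≠] 0)).mul h).congr' ?_ ?_)
  · filter_upwards [self_mem_nhdsWithin] with u hu
    have hu : u ≠ 0 := hu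
    field_simp
  · exact .of_forall fun u => mul_one u

theorem tendsto_div_of_isBigO_linear
    (h : (fun u => f u - a * u) =O[𝓝[≠] 0] fun u => u ^ 2) :
    Tendsto (fun u => f u / u) (𝓝[≠] 0) (𝓝 a) := by
  refine tendsto_of_isBigO_const
    (((isBigO_refl (fun u : ℂ => u⁻¹) (𝓝[≠] 0)).mul h).congr' ?_ ?_)
  · filter_upwards [self_mem_nhdsWithin] with u hu
    have hu : u ≠ 0 := hu
    field_simp
  · filter_upwards [self_mem_nhdsWithin] with u hu
    have hu : u ≠ 0 := hu
    field_simp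

end Limits

/-! ### The blocks in terms of F and theta functions -/

variable {s : ℂ}

/-- Each quotient `(q y²; q)_∞ / (q y²; q)_k` is `(q^{k+1} y²; q)_∞`; the nonvanishing hypothesis
makes these divisions genuine. -/
theorem qPochInf_mul_tsum (hs0 : s ≠ 0) (hs : ‖s‖ < 1) {y : ℂ}
    (hy : qPochInf (s ^ 2 * y ^ 2) (s ^ 2) ≠ 0) :
    qPochInf (s ^ 2 * y ^ 2) (s ^ 2) *
      ∑' k : ℕ, (-1) ^ k * (s ^ (k * (k + 1)) * y ^ k) /
        (qPoch (s ^ 2) (s ^ 2) k * qPoch (s ^ 2 * y ^ 2) (s ^ 2) k) = blockSeries s y := by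
  have hq := norm_sq_lt_one hs
  rw [blockSeries, ← tsum_mul_left]
  refine tsum_congr fun k => ?_
  have h1 := qPoch_ne_zero hq k
  have h2 := qPoch_ne_zero_of_qPochInf_ne_zero hq hy k
  have h3 : s ^ 2 * y ^ 2 * (s ^ 2) ^ k = (s ^ 2) ^ (k + 1) * y ^ 2 := by ring
  rw [qPochInf_eq_qPoch_mul hq (s ^ 2 * y ^ 2) k, h3, blockCoeff]
  field_simp

theorem qPochInf_sq_ne_zero {y : ℂ} (hy : thetaShift s (y ^ 2) ≠ 0) :
    qPochInf (s ^ 2 * y ^ 2) (s ^ 2) ≠ 0 := (mul_ne_zero_iff.1 hy).1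

theorem thetaShift_inv_sq_ne_zero (hs : ‖s‖ < 1) {y : ℂ} (hy0 : y ≠ 0)
    (hy : thetaShift s (y ^ 2) ≠ 0) : thetaShift s (y⁻¹ ^ 2) ≠ 0 := by
  rw [inv_pow, thetaShift_inv hs (pow_ne_zero 2 hy0)]
  exact mul_ne_zero (neg_ne_zero.2 (pow_ne_zero 2 hy0)) hy

theorem blockInside_eq (hs0 : s ≠ 0) (hs : ‖s‖ < 1) {y : ℂ} (hy : thetaShift s (y ^ 2) ≠ 0) :
    blockInside s y = blockSeries s y / blockDenom s y := by
  rw [blockInside, theta_neg_mul hs0, ← qPochInf_mul_tsum hs0 hs (qPochInf_sq_ne_zero hy),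
    blockDenom]
  ring

/-- The prefactor `1/(y⁻²; q)_∞` and the factor `(q y²; q)_∞` absorbed into `F` combine to the
denominator `T(y²)`. -/
theorem blockOutside_inv_eq (hs0 : s ≠ 0) (hs : ‖s‖ < 1) {y : ℂ}
    (hy : thetaShift s (y ^ 2) ≠ 0) :
    blockOutside s y⁻¹ = blockDenom s y * blockSeries s y / thetaShift s (y ^ 2) := by
  have h := qPochInf_sq_ne_zero hy
  rw [blockOutside, theta_neg_inv_mul hs0, inv_inv, theta_inv, ← qPochInf_mul_tsum hs0 hs h,
    blockDenom, thetaShift, thetaShift, inv_pow]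
  field_simp

/-- The combination `F(y) - y⁻¹ F(y⁻¹)` that governs the sum and the difference of the two
holomorphic blocks. -/
noncomputable def blockDiff (s y : ℂ) : ℂ := blockSeries s y - y⁻¹ * blockSeries s y⁻¹

theorem blockInside_add (hs0 : s ≠ 0) (hs : ‖s‖ < 1) {y : ℂ} (hy0 : y ≠ 0)
    (hy : thetaShift s (y ^ 2) ≠ 0) :
    blockInside s y + blockInside s y⁻¹ = blockDiff s y / blockDenom s y := by
  rw [blockInside_eq hs0 hs hy, blockInside_eq hs0 hs (thetaShift_inv_sq_ne_zero hs hy0 hy),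
    blockDenom_inv hs hy0, blockDiff, ← div_div, div_neg]
  ring

/-- Under `y ↦ y⁻¹`, `D` gains `-y` and `T(y²)` gains `-y²`, so the quotient gains `y⁻¹`, the
coefficient in `blockDiff`. -/
theorem blockOutside_sub (hs0 : s ≠ 0) (hs : ‖s‖ < 1) {y : ℂ} (hy0 : y ≠ 0)
    (hy : thetaShift s (y ^ 2) ≠ 0) :
    blockOutside s y⁻¹ - blockOutside s y =
      blockDenom s y * blockDiff s y / thetaShift s (y ^ 2) := by
  have h := blockOutside_inv_eq hs0 hs (thetaShift_inv_sq_ne_zero hs hy0 hy)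
  rw [inv_inv, blockDenom_inv hs hy0, inv_pow, thetaShift_inv hs (pow_ne_zero 2 hy0)] at h
  rw [h, blockOutside_inv_eq hs0 hs hy, blockDiff]
  field_simp

theorem blockSeries_zpow (hs0 : s ≠ 0) (hs : ‖s‖ < 1) (n : ℤ) :
    blockSeries s ((s ^ 2) ^ n)⁻¹ = (s ^ 2) ^ n * blockSeries s ((s ^ 2) ^ n) := by
  have hq0 : s ^ 2 ≠ 0 := pow_ne_zero _ hs0
  obtain ⟨m, rfl | rfl⟩ := n.eq_nat_or_neg
  · simpa using blockSeries_inv_pow hs0 hs m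
  · have h := blockSeries_inv_pow hs0 hs m
    rw [zpow_neg, zpow_natCast, inv_inv, h, inv_mul_cancel_left₀ (pow_ne_zero m hq0)]

theorem blockDiff_pt_zero (hs0 : s ≠ 0) (hs : ‖s‖ < 1) (n : ℤ) : blockDiff s (pt s n 0) = 0 := by
  have := zpow_ne_zero n (pow_ne_zero 2 hs0)
  rw [blockDiff, pt_zero, blockSeries_zpow hs0 hs, inv_mul_cancel_left₀ this, sub_self]

theorem hasDerivAt_blockDiff_pt (hs0 : s ≠ 0) (hs : ‖s‖ < 1) (n : ℤ) (u : ℂ) :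
    HasDerivAt (fun u => blockDiff s (pt s n u))
      (pt s n u * deriv (blockSeries s) (pt s n u) + (pt s n u)⁻¹ * (blockSeries s (pt s n u)⁻¹ +
        (pt s n u)⁻¹ * deriv (blockSeries s) (pt s n u)⁻¹)) u := by
  have hF := differentiable_blockSeries hs0 hs
  have h1 := (hF (pt s n u)).hasDerivAt.comp u (hasDerivAt_pt s n u)
  have hi := hasDerivAt_inv_pt hs0 n u
  have h2 := (hF (pt s n u)⁻¹).hasDerivAt.comp u hi
  exact (h1.fun_sub (hi.fun_mul h2)).congr_deriv (by simp only [Function.comp_apply]; ring)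

theorem differentiable_blockDiff_pt (hs0 : s ≠ 0) (hs : ‖s‖ < 1) (n : ℤ) :
    Differentiable ℂ fun u => blockDiff s (pt s n u) :=
  fun u => (hasDerivAt_blockDiff_pt hs0 hs n u).differentiableAt

theorem differentiable_blockSeries_pt (hs0 : s ≠ 0) (hs : ‖s‖ < 1) (n : ℤ) :
    Differentiable ℂ fun u => blockSeries s (pt s n u) :=
  (differentiable_blockSeries hs0 hs).comp (differentiable_pt s n)

/-- The common value of `h^{(0)}_n(q)` and `h^{(0)}_n(q⁻¹)`, for `|q| < 1`. -/
noncomputable def zerothValue (s : ℂ) (n : ℤ) : ℂ :=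
  (-1) ^ n * s ^ (n * (2 * n + 1)) * (blockSeries s ((s ^ 2) ^ n) / qPochInf (s ^ 2) (s ^ 2))

/-- The common value of `h^{(1)}_n(q)` and `-h^{(1)}_n(q⁻¹)`, for `|q| < 1`. -/
noncomputable def firstValue (s : ℂ) (n : ℤ) : ℂ :=
  (-1) ^ n * s ^ (n * (2 * n + 1)) *
    (deriv (fun u => blockDiff s (pt s n u)) 0 / qPochInf (s ^ 2) (s ^ 2))

/-! ### Expansions of the blocks at u = 0 -/

theorem eventually_thetaShift_ne_zero (hs0 : s ≠ 0) (hs : ‖s‖ < 1) (n : ℤ) :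
    ∀ᶠ u in 𝓝[≠] 0, thetaShift s (pt s n u ^ 2) ≠ 0 := by
  refine (hasDerivAt_thetaShift_pt_sq hs0 hs n).eventually_ne ?_
  have hq := norm_sq_lt_one hs
  exact mul_ne_zero (zpow_ne_zero _ hs0)
    (mul_ne_zero two_ne_zero (pow_ne_zero 2 (qPochInf_ne_zero_of_norm_lt_one hq hq)))

theorem neg_one_zpow_mul_self (n : ℤ) : (-1 : ℂ) ^ n * (-1) ^ n = 1 := by
  rw [← mul_zpow]; simp

theorem div_blockDenom_deriv (hs0 : s ≠ 0) (hs : ‖s‖ < 1) (n : ℤ) (a : ℂ) :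
    a / ((-1) ^ n * s ^ (-(n * (2 * n + 1))) * (qPochInf (s ^ 2) (s ^ 2) * normFactor s)) =
      1 / normFactor s *
        ((-1) ^ n * s ^ (n * (2 * n + 1)) * (a / qPochInf (s ^ 2) (s ^ 2))) := by
  have h1 := normFactor_ne_zero hs
  have hq := norm_sq_lt_one hs
  have h2 := qPochInf_ne_zero_of_norm_lt_one hq hq
  have h3 := neg_one_zpow_mul_self n
  have h4 : (-1 : ℂ) ^ n ≠ 0 := left_ne_zero_of_mul_eq_one h3
  have h5 := zpow_ne_zero (n * (2 * n + 1)) hs0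
  rw [zpow_neg]
  field_simp
  linear_combination (-a) * h3

theorem blockDenom_deriv_ne_zero (hs0 : s ≠ 0) (hs : ‖s‖ < 1) (n : ℤ) :
    (-1) ^ n * s ^ (-(n * (2 * n + 1))) * (qPochInf (s ^ 2) (s ^ 2) * normFactor s) ≠ 0 := by
  have hq := norm_sq_lt_one hs
  exact mul_ne_zero (mul_ne_zero (zpow_ne_zero _ (by norm_num)) (zpow_ne_zero _ hs0))
    (mul_ne_zero (qPochInf_ne_zero_of_norm_lt_one hq hq) (normFactor_ne_zero hs))

theorem thetaShift_deriv_ne_zero (hs0 : s ≠ 0) (hs : ‖s‖ < 1) (n : ℤ) :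
    s ^ (-(2 * n * (2 * n + 1))) * (2 * qPochInf (s ^ 2) (s ^ 2) ^ 2) ≠ 0 := by
  have hq := norm_sq_lt_one hs
  exact mul_ne_zero (zpow_ne_zero _ hs0)
    (mul_ne_zero two_ne_zero (pow_ne_zero _ (qPochInf_ne_zero_of_norm_lt_one hq hq)))

/-- The power of `s` in the derivative of `T(y²)` is the square of that in the derivative of `D`, so
their quotient carries the same prefactor `(-1)^n s^{n(2n+1)}` as the reciprocal in
`div_blockDenom_deriv`. Hence both regimes share the same values. -/
theorem blockDenom_deriv_mul_div (hs0 : s ≠ 0) (hs : ‖s‖ < 1) (n : ℤ) (a : ℂ) :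
    (-1) ^ n * s ^ (-(n * (2 * n + 1))) * (qPochInf (s ^ 2) (s ^ 2) * normFactor s) * a /
        (s ^ (-(2 * n * (2 * n + 1))) * (2 * qPochInf (s ^ 2) (s ^ 2) ^ 2)) =
      normFactor s / 2 *
        ((-1) ^ n * s ^ (n * (2 * n + 1)) * (a / qPochInf (s ^ 2) (s ^ 2))) := by
  have hq := norm_sq_lt_one hs
  have h2 := qPochInf_ne_zero_of_norm_lt_one hq hq
  have h5 := zpow_ne_zero (n * (2 * n + 1)) hs0
  have h6 : s ^ (-(2 * n * (2 * n + 1))) =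
      (s ^ (n * (2 * n + 1)))⁻¹ * (s ^ (n * (2 * n + 1)))⁻¹ := by
    rw [← zpow_neg, ← zpow_add₀ hs0]; congr 1; ring
  rw [h6, zpow_neg]
  field_simp

theorem isBigO_blockInside (hs0 : s ≠ 0) (hs : ‖s‖ < 1) (n : ℤ) :
    (fun u => blockInside s (pt s n u) - 1 / normFactor s * zerothValue s n * u⁻¹)
      =O[𝓝[≠] 0] fun _ => (1 : ℂ) := by
  have h := isBigO_div_sub_pole (differentiable_blockSeries_pt hs0 hs n)
    (differentiable_blockDenom_pt hs0 hs n) (blockDenom_pt_zero hs0 hs n)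
    (hasDerivAt_blockDenom_pt hs0 hs n) (blockDenom_deriv_ne_zero hs0 hs n)
  refine h.congr' ?_ .rfl
  filter_upwards [eventually_thetaShift_ne_zero hs0 hs n] with u hu
  rw [div_blockDenom_deriv hs0 hs, blockInside_eq hs0 hs hu, zerothValue, pt_zero]

theorem isBigO_blockInside_add (hs0 : s ≠ 0) (hs : ‖s‖ < 1) (n : ℤ) :
    (fun u => blockInside s (pt s n u) + blockInside s (pt s n u)⁻¹ -
        1 / normFactor s * firstValue s n) =O[𝓝[≠] 0] fun u => u := by
  have h := isBigO_div_sub_const (differentiable_blockDiff_pt hs0 hs n)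
    (blockDiff_pt_zero hs0 hs n) (differentiable_blockDiff_pt hs0 hs n 0).hasDerivAt
    (differentiable_blockDenom_pt hs0 hs n) (blockDenom_pt_zero hs0 hs n)
    (hasDerivAt_blockDenom_pt hs0 hs n) (blockDenom_deriv_ne_zero hs0 hs n)
  refine h.congr' ?_ .rfl
  filter_upwards [eventually_thetaShift_ne_zero hs0 hs n] with u hu
  rw [div_blockDenom_deriv hs0 hs, blockInside_add hs0 hs (pt_ne_zero hs0 n u) hu, firstValue]

theorem isBigO_blockOutside (hs0 : s ≠ 0) (hs : ‖s‖ < 1) (n : ℤ) :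
    (fun u => blockOutside s (pt s n u)⁻¹ - normFactor s / 2 * zerothValue s n)
      =O[𝓝[≠] 0] fun u => u := by
  have hD := differentiable_blockDenom_pt hs0 hs n
  have hF := differentiable_blockSeries_pt hs0 hs n
  have hDF := (hasDerivAt_blockDenom_pt hs0 hs n).fun_mul (hF 0).hasDerivAt
  rw [blockDenom_pt_zero hs0 hs, zero_mul, add_zero] at hDF
  have h := isBigO_div_sub_const (hD.fun_mul hF) (by rw [blockDenom_pt_zero hs0 hs, zero_mul])
    hDF (differentiable_thetaShift_pt_sq hs0 hs n) (thetaShift_pt_sq_zero hs0 hs n)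
    (hasDerivAt_thetaShift_pt_sq hs0 hs n) (thetaShift_deriv_ne_zero hs0 hs n)
  refine h.congr' ?_ .rfl
  filter_upwards [eventually_thetaShift_ne_zero hs0 hs n] with u hu
  rw [blockDenom_deriv_mul_div hs0 hs, blockOutside_inv_eq hs0 hs hu, zerothValue, pt_zero]

theorem isBigO_blockOutside_sub (hs0 : s ≠ 0) (hs : ‖s‖ < 1) (n : ℤ) :
    (fun u => blockOutside s (pt s n u)⁻¹ - blockOutside s (pt s n u) -
        normFactor s / 2 * firstValue s n * u) =O[𝓝[≠] 0] fun u => u ^ 2 := by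
  have h := isBigO_mul_div_sub_linear (differentiable_blockDenom_pt hs0 hs n)
    (blockDenom_pt_zero hs0 hs n) (hasDerivAt_blockDenom_pt hs0 hs n)
    (differentiable_blockDiff_pt hs0 hs n)
    (blockDiff_pt_zero hs0 hs n) (differentiable_blockDiff_pt hs0 hs n 0).hasDerivAt
    (differentiable_thetaShift_pt_sq hs0 hs n) (thetaShift_pt_sq_zero hs0 hs n)
    (hasDerivAt_thetaShift_pt_sq hs0 hs n) (thetaShift_deriv_ne_zero hs0 hs n)
  refine h.congr' ?_ .rfl
  filter_upwards [eventually_thetaShift_ne_zero hs0 hs n] with u hu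
  rw [blockDenom_deriv_mul_div hs0 hs, blockOutside_sub hs0 hs (pt_ne_zero hs0 n u) hu,
    firstValue]

/-! ### Identification of the colored blocks, and symmetry in n -/

theorem h0_eq (hs0 : s ≠ 0) (hs : ‖s‖ < 1) (n : ℤ) : h0 s n = zerothValue s n := by
  have hC := normFactor_ne_zero hs
  have h := (tendsto_mul_of_isBigO_pole (isBigO_blockInside hs0 hs n)).const_mul (normFactor s)
  rw [one_div, mul_inv_cancel_left₀ hC] at h
  simp only [h0, block1, if_pos hs]
  exact h.limUnder_eq

theorem h1_eq (hs0 : s ≠ 0) (hs : ‖s‖ < 1) (n : ℤ) : h1 s n = firstValue s n := by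
  have hC := normFactor_ne_zero hs
  have h := (tendsto_of_isBigO_const (isBigO_blockInside_add hs0 hs n)).const_mul (normFactor s)
  rw [one_div, mul_inv_cancel_left₀ hC] at h
  simp only [h1, block1, block2, if_pos hs]
  exact h.limUnder_eq

theorem norm_inv_not_lt_one (hs0 : s ≠ 0) (hs : ‖s‖ < 1) : ¬‖s⁻¹‖ < 1 := by
  rw [norm_inv, not_lt]
  exact (one_lt_inv₀ (norm_pos_iff.2 hs0)).2 hs |>.le

theorem block1_inv_pt (hs0 : s ≠ 0) (hs : ‖s‖ < 1) (n : ℤ) (u : ℂ) :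
    block1 s⁻¹ (pt s⁻¹ n (-u)) = blockOutside s (pt s n u)⁻¹ := by
  rw [block1, if_neg (norm_inv_not_lt_one hs0 hs), ← inv_pt_inv, inv_inv]

theorem block2_inv_pt (hs0 : s ≠ 0) (hs : ‖s‖ < 1) (n : ℤ) (u : ℂ) :
    block2 s⁻¹ (pt s⁻¹ n (-u)) = blockOutside s (pt s n u) := by
  rw [block2, block1, if_neg (norm_inv_not_lt_one hs0 hs), ← inv_pt_inv, inv_inv, inv_inv]

theorem h0_inv_eq (hs0 : s ≠ 0) (hs : ‖s‖ < 1) (n : ℤ) : h0 s⁻¹ n = zerothValue s n := by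
  have hC := normFactor_ne_zero hs
  have h := (tendsto_of_isBigO_const (isBigO_blockOutside hs0 hs n)).const_mul (2 / normFactor s)
  have e : 2 / normFactor s * (normFactor s / 2 * zerothValue s n) = zerothValue s n := by
    field_simp
  rw [e] at h
  simp only [h0, if_neg (norm_inv_not_lt_one hs0 hs), block1_inv_pt hs0 hs, inv_inv]
  exact h.limUnder_eq

theorem h1_inv_eq (hs0 : s ≠ 0) (hs : ‖s‖ < 1) (n : ℤ) : h1 s⁻¹ n = -firstValue s n := by
  have hC := normFactor_ne_zero hs
  have h := (tendsto_div_of_isBigO_linear (isBigO_blockOutside_sub hs0 hs n)).const_mul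
    (-(2 / normFactor s))
  have e : -(2 / normFactor s) * (normFactor s / 2 * firstValue s n) = -firstValue s n := by
    field_simp
  rw [e] at h
  simp only [h1, if_neg (norm_inv_not_lt_one hs0 hs), block1_inv_pt hs0 hs,
    block2_inv_pt hs0 hs, inv_inv]
  exact h.limUnder_eq

theorem zerothValue_neg (hs0 : s ≠ 0) (hs : ‖s‖ < 1) (n : ℤ) :
    zerothValue s (-n) = zerothValue s n := by
  have h1 : s ^ (n * (2 * n + 1)) = s ^ (-n * (2 * -n + 1)) * (s ^ 2) ^ n := by
    rw [← zpow_natCast s 2, ← zpow_mul, ← zpow_add₀ hs0]; congr 1; push_cast; ring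
  have h2 : (-1 : ℂ) ^ (-n) = (-1) ^ n := by rw [zpow_neg, ← inv_zpow]; norm_num
  rw [zerothValue, zerothValue, h1, h2, zpow_neg (s ^ 2), blockSeries_zpow hs0 hs]
  ring

/-- Reflects `G(y⁻¹) = -y G(y)` at a zero of `G`: the sign cancels against that of `u ↦ -u`. -/
theorem deriv_blockDiff_pt_neg (hs0 : s ≠ 0) (hs : ‖s‖ < 1) (n : ℤ) :
    deriv (fun u => blockDiff s (pt s (-n) u)) 0 =
      (s ^ 2) ^ n * deriv (fun u => blockDiff s (pt s n u)) 0 := by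
  have h0 := zpow_ne_zero n (pow_ne_zero 2 hs0)
  rw [(hasDerivAt_blockDiff_pt hs0 hs _ 0).deriv, (hasDerivAt_blockDiff_pt hs0 hs _ 0).deriv,
    pt_zero, pt_zero, zpow_neg, inv_inv, blockSeries_zpow hs0 hs]
  field_simp
  ring

theorem firstValue_neg (hs0 : s ≠ 0) (hs : ‖s‖ < 1) (n : ℤ) :
    firstValue s (-n) = firstValue s n := by
  have h1 : s ^ (n * (2 * n + 1)) = s ^ (-n * (2 * -n + 1)) * (s ^ 2) ^ n := by
    rw [← zpow_natCast s 2, ← zpow_mul, ← zpow_add₀ hs0]; congr 1; push_cast; ring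
  have h2 : (-1 : ℂ) ^ (-n) = (-1) ^ n := by rw [zpow_neg, ← inv_zpow]; norm_num
  rw [firstValue, firstValue, h1, h2, deriv_blockDiff_pt_neg hs0 hs]
  ring

end FigureEight

/-! ### The closed formulas -/

namespace FigureEight

variable {s : ℂ}

/-- The closed formula for `h^{(0)}_n(q)`. -/
noncomputable def zerothFormula (s : ℂ) (n : ℤ) : ℂ :=
  (-1) ^ n * s ^ (n.natAbs * (2 * n.natAbs + 1)) * ∑' k : ℕ, term s n.natAbs k

/-- The summand of the infinite series in the closed formula for `h^{(1)}_n(q)`. -/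
noncomputable def firstSummand (s : ℂ) (m k : ℕ) : ℂ :=
  (-4 * E 1 (s ^ 2) + qHarm (s ^ 2) (k + 2 * m) + qHarm (s ^ 2) k) * term s m k

/-- The summand of the finite sum in the closed formula for `h^{(1)}_n(q)`. -/
noncomputable def correctionSummand (s : ℂ) (m k : ℕ) : ℂ :=
  (-1) ^ k * s ^ ((k : ℤ) * ((k : ℤ) + 1) - 2 * (m : ℤ) * (k : ℤ)) *
    qPoch (s ^ 2)⁻¹ (s ^ 2)⁻¹ (2 * m - 1 - k) / qPoch (s ^ 2) (s ^ 2) k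

/-- The closed formula for `h^{(1)}_n(q)`. -/
noncomputable def firstFormula (s : ℂ) (n : ℤ) : ℂ :=
  (-1) ^ n * s ^ (n.natAbs * (2 * n.natAbs + 1)) * ∑' k : ℕ, firstSummand s n.natAbs k -
    2 * (-1) ^ n * s ^ ((n.natAbs : ℤ) * (2 * (n.natAbs : ℤ) - 1)) *
      ∑ k ∈ Finset.range (2 * n.natAbs), correctionSummand s n.natAbs k

theorem hasSum_term_div (hs0 : s ≠ 0) (hs : ‖s‖ < 1) (m : ℕ) :
    HasSum (term s m) (blockSeries s ((s ^ 2) ^ m) / qPochInf (s ^ 2) (s ^ 2)) := by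
  have hq := norm_sq_lt_one hs
  have hP := qPochInf_ne_zero_of_norm_lt_one hq hq
  exact hasSum_of_eq (fun k => (mul_div_cancel_right₀ _ hP).symm)
    ((hasSum_term hs0 hs m).div_const _)

theorem correctionSummand_eq (hs0 : s ≠ 0) (m k : ℕ) :
    correctionSummand s m k = blockCoeff s k * ((s ^ 2) ^ m)⁻¹ ^ k *
      qPoch (s ^ 2)⁻¹ (s ^ 2)⁻¹ (2 * m - 1 - k) := by
  have h : s ^ ((k : ℤ) * ((k : ℤ) + 1) - 2 * (m : ℤ) * (k : ℤ)) =
      s ^ (k * (k + 1)) * ((s ^ 2) ^ m)⁻¹ ^ k := by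
    rw [zpow_sub₀ hs0, div_eq_mul_inv, inv_pow, ← pow_mul, ← pow_mul, ← mul_assoc]
    norm_cast
  rw [correctionSummand, blockCoeff, h]
  ring

theorem hasSum_firstSummand (hs0 : s ≠ 0) (hs : ‖s‖ < 1) (m : ℕ) :
    HasSum (firstSummand s m)
      (deriv (fun u => blockDiff s (pt s m u)) 0 / qPochInf (s ^ 2) (s ^ 2) +
        2 * ((s ^ 2) ^ m)⁻¹ * ∑ k ∈ Finset.range (2 * m), correctionSummand s m k) := by
  have hq := norm_sq_lt_one hs
  have hP := qPochInf_ne_zero_of_norm_lt_one hq hq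
  have hqm : (s ^ 2) ^ m ≠ 0 := pow_ne_zero _ (pow_ne_zero _ hs0)
  have h := (((hasSum_deriv_pow hs0 hs m).add (hasSum_term hs0 hs m)).add
    ((hasSum_deriv_inv_pow hs0 hs m).mul_left ((s ^ 2) ^ m)⁻¹)).div_const
      (qPochInf (s ^ 2) (s ^ 2))
  -- Two logarithmic derivatives contribute `-4 E₁ - 1`; the summand `1`, from differentiating the
  -- factor `y⁻¹` in `blockDiff`, cancels the `-1`.
  have hk (k : ℕ) : -4 * E 1 (s ^ 2) + qHarm (s ^ 2) (k + 2 * m) + qHarm (s ^ 2) k =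
      (k + 2 * logDerivCoeff (s ^ 2) (k + 2 * m)) + 1 +
        (k + 2 * m + 2 * logDerivCoeff (s ^ 2) k) := by
    have h1 := natCast_add_two_mul_logDerivCoeff hq (k + 2 * m)
    have h2 := natCast_add_two_mul_logDerivCoeff hq k
    push_cast at h1
    linear_combination -h1 - h2
  convert hasSum_of_eq (fun k => ?_) h using 1
  rotate_left
  · rw [firstSummand, hk]
    field_simp
  · simp only [correctionSummand_eq hs0]
    rw [(hasDerivAt_blockDiff_pt hs0 hs m 0).deriv, pt_zero, zpow_natCast,
      blockSeries_inv_pow hs0 hs]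
    field_simp
    ring

theorem neg_one_zpow_natAbs (n : ℤ) : (-1 : ℂ) ^ (n.natAbs : ℤ) = (-1) ^ n := by
  obtain ⟨m, rfl | rfl⟩ := n.eq_nat_or_neg
  · simp
  · rw [Int.natAbs_neg, Int.natAbs_natCast, zpow_neg, ← inv_zpow]; norm_num

theorem zerothValue_eq_zerothFormula (hs0 : s ≠ 0) (hs : ‖s‖ < 1) (n : ℤ) :
    zerothValue s n = zerothFormula s n := by
  have h : zerothValue s n = zerothValue s n.natAbs := by
    obtain h | h := n.natAbs_eq
    · rw [← h]
    · conv_lhs => rw [h, zerothValue_neg hs0 hs]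
  rw [h, zerothValue, zerothFormula, (hasSum_term_div hs0 hs _).tsum_eq, neg_one_zpow_natAbs,
    zpow_natCast]
  norm_cast

theorem firstValue_eq_firstFormula (hs0 : s ≠ 0) (hs : ‖s‖ < 1) (n : ℤ) :
    firstValue s n = firstFormula s n := by
  have h : firstValue s n = firstValue s n.natAbs := by
    obtain h | h := n.natAbs_eq
    · rw [← h]
    · conv_lhs => rw [h, firstValue_neg hs0 hs]
  rw [h, firstValue, firstFormula, (hasSum_firstSummand hs0 hs _).tsum_eq, neg_one_zpow_natAbs]
  generalize n.natAbs = m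
  have h1 : s ^ ((m : ℤ) * (2 * m - 1)) = s ^ (m * (2 * m + 1)) * ((s ^ 2) ^ m)⁻¹ := by
    have : (m : ℤ) * (2 * m - 1) = m * (2 * m + 1) - 2 * m := by ring
    rw [this, zpow_sub₀ hs0, div_eq_mul_inv, ← pow_mul]
    norm_cast
  have h2 : s ^ ((m : ℤ) * (2 * m + 1)) = s ^ (m * (2 * m + 1)) := by norm_cast
  rw [h1, h2]
  ring

/-! ### Behaviour of the closed formulas under inversion of q -/

theorem qPoch_inv (hs0 : s ≠ 0) (k : ℕ) : qPoch (s ^ 2)⁻¹ (s ^ 2)⁻¹ k =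
    (-1) ^ k * (s ^ (k * (k + 1)))⁻¹ * qPoch (s ^ 2) (s ^ 2) k := by
  induction k with
  | zero => simp [qPoch]
  | succ k ih =>
    rw [qPoch] at ih
    rw [qPoch, qPoch, Finset.prod_range_succ, Finset.prod_range_succ, ih, ← qPoch, inv_pow _ k]
    field_simp
    ring

/-- The signs of the two Pochhammer symbols cancel and the ratio does not depend on `k`, so it
leaves the sum and is absorbed by the prefactor. -/
theorem term_inv (hs0 : s ≠ 0) (hs : ‖s‖ < 1) (m k : ℕ) :
    term s⁻¹ m k = s ^ (2 * (m * (2 * m + 1))) * term s m k := by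
  have hq := norm_sq_lt_one hs
  have h1 := qPoch_ne_zero hq k
  have h2 := qPoch_ne_zero hq (k + 2 * m)
  have h3 : (-1 : ℂ) ^ (k + 2 * m) = (-1) ^ k := by rw [pow_add, pow_mul]; simp
  have h4 : s ^ (k * (k + 1)) * s ^ ((k + 2 * m) * (k + 2 * m + 1)) =
      s ^ (2 * (m * (2 * m + 1))) * s ^ (k * (k + 1) + 2 * m * k) *
        s ^ (k * (k + 1) + 2 * m * k) := by
    simp only [← pow_add]; congr 1; ring
  have h5 : (-1 : ℂ) ^ k * (-1) ^ k = 1 := by rw [← mul_pow]; simp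
  have h6 : term s⁻¹ m k = (-1) ^ k * (s ^ (k * (k + 1) + 2 * m * k))⁻¹ /
      ((-1) ^ k * (-1) ^ k * (s ^ (k * (k + 1)) * s ^ ((k + 2 * m) * (k + 2 * m + 1)))⁻¹ *
        (qPoch (s ^ 2) (s ^ 2) k * qPoch (s ^ 2) (s ^ 2) (k + 2 * m))) := by
    rw [term, inv_pow s 2, qPoch_inv hs0, qPoch_inv hs0, h3, inv_pow, mul_inv (s ^ (k * (k + 1)))]
    congr 1
    ring
  rw [h6, h5, h4, term]
  field_simp

theorem qHarm_inv {q : ℂ} (hq0 : q ≠ 0) (m : ℕ) : qHarm q⁻¹ m = -qHarm q m := by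
  rw [qHarm, qHarm, ← Finset.sum_neg_distrib]
  refine Finset.sum_congr rfl fun l _ => ?_
  have hl : q ^ l ≠ 0 := pow_ne_zero _ hq0
  have h1 : 1 + q⁻¹ ^ l = (1 + q ^ l) * (q ^ l)⁻¹ := by rw [inv_pow]; field_simp; ring
  have h2 : 1 - q⁻¹ ^ l = -(1 - q ^ l) * (q ^ l)⁻¹ := by rw [inv_pow]; field_simp; ring
  rw [h1, h2, mul_div_mul_right _ _ (inv_ne_zero hl), div_neg]

theorem E_inv {q : ℂ} (hq0 : q ≠ 0) (hq : ‖q‖ < 1) (l : ℕ) : E l q⁻¹ = -E l q := by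
  rw [E, E, if_pos hq, if_neg (norm_inv_not_lt_one hq0 hq), inv_inv]

theorem firstSummand_inv (hs0 : s ≠ 0) (hs : ‖s‖ < 1) (m k : ℕ) :
    firstSummand s⁻¹ m k = -s ^ (2 * (m * (2 * m + 1))) * firstSummand s m k := by
  have hq0 : s ^ 2 ≠ 0 := pow_ne_zero _ hs0
  rw [firstSummand, firstSummand, term_inv hs0 hs, inv_pow, E_inv hq0 (norm_sq_lt_one hs),
    qHarm_inv hq0, qHarm_inv hq0]
  ring

theorem correctionSummand_inv (hs0 : s ≠ 0) (hs : ‖s‖ < 1) {m k : ℕ} (hk : k < 2 * m) :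
    correctionSummand s⁻¹ m k =
      -s ^ (2 * ((m : ℤ) * (2 * m - 1))) * correctionSummand s m k := by
  have hq := norm_sq_lt_one hs
  -- With the complementary index `j`, `j + k = 2m - 1` is odd, which produces the sign, and
  -- `(j+k)(j+k+1) = 2jk + k(k+1) + j(j+1)` matches the exponents.
  obtain ⟨j, hj⟩ : ∃ j, j = 2 * m - 1 - k := ⟨_, rfl⟩
  have hjk : 2 * (m : ℤ) = j + k + 1 := by omega
  have hQ := qPoch_ne_zero hq k
  have h1 : 2 * ((m : ℤ) * (2 * m - 1)) = ((j + k : ℕ) : ℤ) * (j + k + 1 : ℕ) := by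
    push_cast
    linear_combination (2 * (m : ℤ) + j + k) * hjk
  have h2 : (k : ℤ) * ((k : ℤ) + 1) - 2 * (m : ℤ) * (k : ℤ) = -((j * k : ℕ) : ℤ) := by
    push_cast
    linear_combination (-(k : ℤ)) * hjk
  have h3 : (-1 : ℂ) ^ j = -(-1) ^ k := by
    have hodd : Odd (j + k) := ⟨m - 1, by omega⟩
    have h4 : (-1 : ℂ) ^ k * (-1) ^ k = 1 := by rw [← mul_pow]; simp
    have h5 : (-1 : ℂ) ^ j * (-1) ^ k = -1 := by rw [← pow_add, hodd.neg_one_pow]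
    linear_combination (-1 : ℂ) ^ k * h5 - (-1 : ℂ) ^ j * h4
  have h4 : (s ^ (2 * ((m : ℤ) * (2 * m - 1)))) = s ^ ((j + k) * (j + k + 1)) := by
    rw [h1]; norm_cast
  have h5 : s ^ ((j + k) * (j + k + 1)) =
      s ^ (j * k) * s ^ (j * k) * s ^ (k * (k + 1)) * s ^ (j * (j + 1)) := by
    simp only [← pow_add]; congr 1; ring
  rw [correctionSummand, correctionSummand, ← hj, h4, h2, inv_pow, inv_inv, qPoch_inv hs0,
    qPoch_inv hs0, inv_zpow, ← zpow_neg, neg_neg, zpow_neg, h3, zpow_natCast, h5]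
  have h6 : (-1 : ℂ) ^ k ≠ 0 := pow_ne_zero _ (by norm_num)
  have h7 : (-1 : ℂ) ^ k * (-1) ^ k = 1 := by rw [← mul_pow]; simp
  field_simp
  linear_combination -qPoch (s ^ 2) (s ^ 2) j * h7

theorem zerothFormula_inv (hs0 : s ≠ 0) (hs : ‖s‖ < 1) (n : ℤ) :
    zerothFormula s⁻¹ n = zerothFormula s n := by
  simp only [zerothFormula, term_inv hs0 hs, tsum_mul_left]
  rw [inv_pow, two_mul (n.natAbs * _), pow_add]
  field_simp

theorem firstFormula_inv (hs0 : s ≠ 0) (hs : ‖s‖ < 1) (n : ℤ) :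
    firstFormula s⁻¹ n = -firstFormula s n := by
  have h : ∑ k ∈ Finset.range (2 * n.natAbs), correctionSummand s⁻¹ n.natAbs k =
      -s ^ (2 * ((n.natAbs : ℤ) * (2 * n.natAbs - 1))) *
        ∑ k ∈ Finset.range (2 * n.natAbs), correctionSummand s n.natAbs k := by
    rw [Finset.mul_sum]
    exact Finset.sum_congr rfl fun k hk => correctionSummand_inv hs0 hs (Finset.mem_range.1 hk)
  simp only [firstFormula, firstSummand_inv hs0 hs, tsum_mul_left, h]
  have h1 := zpow_ne_zero ((n.natAbs : ℤ) * (2 * n.natAbs - 1)) hs0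
  rw [inv_pow, two_mul (n.natAbs * _), pow_add, inv_zpow, two_mul ((n.natAbs : ℤ) * _),
    zpow_add₀ hs0]
  field_simp
  ring

end FigureEight

theorem mainTheorem3 (s : ℂ) (hs0 : s ≠ 0) (hs1 : ‖s‖ ≠ 1) (n : ℤ) :
    -- the Laurent expansions that define the colored holomorphic blocks, `|q| < 1`
    (‖s‖ < 1 →
      ((fun u : ℂ => FigureEight.block1 s (FigureEight.pt s n u) -
          1 / FigureEight.normFactor s * FigureEight.h0 s n * u⁻¹)
        =O[𝓝[≠] 0] fun _ => (1 : ℂ)) ∧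
      ((fun u : ℂ => FigureEight.block1 s (FigureEight.pt s n u) +
          FigureEight.block2 s (FigureEight.pt s n u) -
          1 / FigureEight.normFactor s * FigureEight.h1 s n)
        =O[𝓝[≠] 0] fun u => u)) ∧
    -- the expansions that define the colored holomorphic blocks, `|q| > 1`
    (1 < ‖s‖ →
      ((fun u : ℂ => FigureEight.block1 s (FigureEight.pt s n (-u)) -
          FigureEight.normFactor s⁻¹ / 2 * FigureEight.h0 s n)
        =O[𝓝[≠] 0] fun u => u) ∧
      ((fun u : ℂ => FigureEight.block1 s (FigureEight.pt s n (-u)) -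
          FigureEight.block2 s (FigureEight.pt s n (-u)) -
          -(FigureEight.normFactor s⁻¹ / 2 * FigureEight.h1 s n * u))
        =O[𝓝[≠] 0] fun u => u ^ 2)) ∧
    -- the formula for `h^{(0)}_n(q)`
    Summable (fun k : ℕ => FigureEight.term s n.natAbs k) ∧
    FigureEight.h0 s n =
      (-1) ^ n * s ^ (n.natAbs * (2 * n.natAbs + 1)) *
        ∑' k : ℕ, FigureEight.term s n.natAbs k ∧
    -- the formula for `h^{(1)}_n(q)`
    Summable (fun k : ℕ =>
      (-4 * FigureEight.E 1 (s ^ 2) + FigureEight.qHarm (s ^ 2) (k + 2 * n.natAbs) +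
        FigureEight.qHarm (s ^ 2) k) * FigureEight.term s n.natAbs k) ∧
    FigureEight.h1 s n =
      (-1) ^ n * s ^ (n.natAbs * (2 * n.natAbs + 1)) *
        ∑' k : ℕ, (-4 * FigureEight.E 1 (s ^ 2) +
          FigureEight.qHarm (s ^ 2) (k + 2 * n.natAbs) + FigureEight.qHarm (s ^ 2) k) *
            FigureEight.term s n.natAbs k -
      2 * (-1) ^ n * s ^ ((n.natAbs : ℤ) * (2 * (n.natAbs : ℤ) - 1)) *
        ∑ k ∈ Finset.range (2 * n.natAbs),
          (-1) ^ k * s ^ ((k : ℤ) * ((k : ℤ) + 1) - 2 * (n.natAbs : ℤ) * (k : ℤ)) *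
            FigureEight.qPoch (s ^ 2)⁻¹ (s ^ 2)⁻¹ (2 * n.natAbs - 1 - k) /
              FigureEight.qPoch (s ^ 2) (s ^ 2) k ∧
    -- the symmetries
    FigureEight.h0 s⁻¹ n = FigureEight.h0 s n ∧
    FigureEight.h1 s⁻¹ n = -FigureEight.h1 s n ∧
    FigureEight.h0 s (-n) = FigureEight.h0 s n ∧
    FigureEight.h1 s (-n) = FigureEight.h1 s n := by
  obtain hs | hs := lt_or_gt_of_ne hs1
  · have hsum0 := (FigureEight.hasSum_term_div hs0 hs n.natAbs).summable
    have hsum1 := (FigureEight.hasSum_firstSummand hs0 hs n.natAbs).summable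
    refine ⟨fun _ => ?_, fun h => absurd h (not_lt.2 hs.le), hsum0, ?_, hsum1, ?_, ?_, ?_, ?_, ?_⟩
    · simp only [FigureEight.h0_eq hs0 hs, FigureEight.h1_eq hs0 hs, FigureEight.block2,
        FigureEight.block1, if_pos hs]
      exact ⟨FigureEight.isBigO_blockInside hs0 hs n, FigureEight.isBigO_blockInside_add hs0 hs n⟩
    · rw [FigureEight.h0_eq hs0 hs, FigureEight.zerothValue_eq_zerothFormula hs0 hs]
      rfl
    · rw [FigureEight.h1_eq hs0 hs, FigureEight.firstValue_eq_firstFormula hs0 hs]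
      rfl
    · rw [FigureEight.h0_inv_eq hs0 hs, FigureEight.h0_eq hs0 hs]
    · rw [FigureEight.h1_inv_eq hs0 hs, FigureEight.h1_eq hs0 hs]
    · rw [FigureEight.h0_eq hs0 hs, FigureEight.h0_eq hs0 hs, FigureEight.zerothValue_neg hs0 hs]
    · rw [FigureEight.h1_eq hs0 hs, FigureEight.h1_eq hs0 hs, FigureEight.firstValue_neg hs0 hs]
  -- For `|q| > 1` everything is expressed through `t = s⁻¹`, and the formulas are carried over by
  -- their inversion symmetry.
  · obtain ⟨t, rfl⟩ : ∃ t, s = t⁻¹ := ⟨s⁻¹, (inv_inv s).symm⟩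
    have ht0 : t ≠ 0 := by simpa using hs0
    have ht : ‖t‖ < 1 := by
      rw [norm_inv] at hs
      exact (one_lt_inv₀ (norm_pos_iff.2 ht0)).1 hs
    have hsum0 : Summable (FigureEight.term t⁻¹ n.natAbs) := by
      refine Summable.congr ((FigureEight.hasSum_term_div ht0 ht n.natAbs).summable.mul_left _)
        fun k => (FigureEight.term_inv ht0 ht n.natAbs k).symm
    have hsum1 : Summable (FigureEight.firstSummand t⁻¹ n.natAbs) := by
      refine Summable.congr ((FigureEight.hasSum_firstSummand ht0 ht n.natAbs).summable.mul_left _)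
        fun k => (FigureEight.firstSummand_inv ht0 ht n.natAbs k).symm
    refine ⟨fun h => absurd h (not_lt.2 (le_of_lt hs)), fun _ => ?_, hsum0, ?_, hsum1, ?_, ?_, ?_,
      ?_, ?_⟩
    · simp only [FigureEight.h0_inv_eq ht0 ht, FigureEight.h1_inv_eq ht0 ht,
        FigureEight.block1_inv_pt ht0 ht, FigureEight.block2_inv_pt ht0 ht, inv_inv, mul_neg,
        neg_mul, neg_neg]
      exact ⟨FigureEight.isBigO_blockOutside ht0 ht n,
        FigureEight.isBigO_blockOutside_sub ht0 ht n⟩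
    · rw [FigureEight.h0_inv_eq ht0 ht, FigureEight.zerothValue_eq_zerothFormula ht0 ht,
        ← FigureEight.zerothFormula_inv ht0 ht]
      rfl
    · rw [FigureEight.h1_inv_eq ht0 ht, FigureEight.firstValue_eq_firstFormula ht0 ht,
        ← FigureEight.firstFormula_inv ht0 ht]
      rfl
    · rw [inv_inv, FigureEight.h0_inv_eq ht0 ht, FigureEight.h0_eq ht0 ht]
    · rw [inv_inv, FigureEight.h1_inv_eq ht0 ht, FigureEight.h1_eq ht0 ht, neg_neg]
    · rw [FigureEight.h0_inv_eq ht0 ht, FigureEight.h0_inv_eq ht0 ht,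
        FigureEight.zerothValue_neg ht0 ht]
    · rw [FigureEight.h1_inv_eq ht0 ht, FigureEight.h1_inv_eq ht0 ht,
        FigureEight.firstValue_neg ht0 ht]
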